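/- **Covering lemma.** Put $\omega_0=1$ and $\omega_{k+1}=\omega^{\omega_k}$. For every $n\ge 0$ and every $J_n$-tree $\mathcal T=(T,R_0,\dots,R_n)$ there are an ordinal $\lambda<\omega_{n+2}$ and a surjective algebra-preserving $J_n$-morphism $f:([1,\lambda],\vartheta_0,\dots,\vartheta_n,\mathcal H_n)\twoheadrightarrow\mathcal T$. Here the notions are as follows. *Icard topologies.* Let $\ell(0)=0$ and $\ell(\alpha)=\beta$ if $\alpha=\gamma+\omega^\beta$ for some $\gamma$. Then $\vartheta_n$ is the topology on ordinals generated by the interval topology and the sets $\{\alpha:\ell^m(\alpha)>\beta\}$, $m\le n$ ($\ell^m$ is the $m$-th iterate of $\ell$); $[1,\lambda]$ carries the subspace topologies. *Periodic sets.* A binary word of ordinal length is periodic if it is $A^\kappa$ for a nonempty word $A$ and a (nonzero) limit ordinal $\kappa$, and ultimately periodic if it is the concatenation $BY$ of a (possibly empty) word $B$ and a periodic word $Y$. Let $\mathcal H_0(\Omega)$ be the set of all $X\subseteq\Omega$ such that for each limit ordinal $\beta\le\Omega$ the word of length $\beta$ given by the characteristic function of $X\cap\beta$ is ultimately periodic.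 Let $\mathcal V_0(\Omega)=\mathcal H_0(\Omega)$ and $\mathcal V_{m+1}(\Omega)=\{B\cap\ell^{-1}(A): B\in\mathcal H_0(\Omega),\ A\in\mathcal V_m(\Omega)\}$; $\mathcal H_m(\Omega)$ is the set of finite unions of members of $\mathcal V_m(\Omega)$. On $[1,\lambda]$, $\mathcal H_n$ consists of the sets $A\cap[1,\lambda]$ with $A\in\mathcal H_n(\lambda+1)$. *$J_n$-trees.* These are the finite frames defined inductively, up to isomorphism. A $J_0$-tree is a finite rooted irreflexive transitive tree $(W,R_0)$. If $(W,R_0,\dots,R_n)$ is a $J_n$-tree, then $(W,R_0,\dots,R_n)^+:=(W,\emptyset,R_0,\dots,R_n)$ is a $J_{n+1}$-tree. If $\mathcal V$ is a $J_n$-tree and $\mathcal W_1,\dots,\mathcal W_k$ are $J_{n+1}$-trees, then the disjoint sum of $\mathcal V^+,\mathcal W_1,\dots,\mathcal W_k$, with $R_0$ extended by all pairs $(v,w)$ with $v\in V$ and $w\in\bigcup_i W_i$, is a $J_{n+1}$-tree. *Morphisms.* Let $\sigma_k$ be the topology on $T$ of all $R_k$-upsets, let $R_k^*=\bigcup_{i=k}^nR_i$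 and $R_k^*(w)=\{u: w\,R_k^*\,u\}$, and call $w\in T$ a hereditary $k$-root if there is no $v$ with $v\,R_k^*\,w$. A map $f:(X,\tau_0,\dots,\tau_n)\to T$ is a $J_n$-morphism if: ($j_1$) $f:(X,\tau_n)\to(T,\sigma_n)$ is continuous, open, and has discrete fibres; ($j_2$) $f:(X,\tau_k)\to(T,\sigma_k)$ is open for all $k\le n$; and for each $k<n$ and each hereditary $(k+1)$-root $w$, ($j_3$) $f^{-1}(R_k^*(w))$ and $f^{-1}(R_k^*(w)\cup\{w\})$ are $\tau_k$-open, and ($j_4$) $f^{-1}(w)$ is a $\tau_k$-discrete subspace. The map $f:[1,\lambda]\to T$ is algebra preserving if $f^{-1}(A)\in\mathcal H_n$ for every $A\subseteq T$. -/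

import Mathlib

open scoped Ordinal Topology

universe u v

namespace OrdGLP

/-! ### The function `ℓ` and Icard's topologies -/

/-- `ℓ 0 = 0` and `ℓ α = β` if `α = γ + ω ^ β` for some `γ`.
(For `α ≠ 0` the set below is a singleton, for `α = 0` it is empty and its infimum is `0`;
see `ell_zero`, `ell_add_opow`, `exists_eq_add_opow_ell`.) -/
noncomputable def ell (α : Ordinal.{v}) : Ordinal.{v} :=
  sInf {β | ∃ γ, α = γ + ω ^ β}

theorem add_opow_inj {γ γ' β β' : Ordinal.{v}} (h : γ + ω ^ β = γ' + ω ^ β') : β = β' := by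
  have key : ∀ {γ δ β : Ordinal.{v}}, γ ≤ δ → δ < γ + ω ^ β → γ + ω ^ β - δ = ω ^ β := by
    intro γ δ β h1 h2
    obtain ⟨ε, rfl⟩ : ∃ ε, δ = γ + ε := ⟨δ - γ, (Ordinal.add_sub_cancel_of_le h1).symm⟩
    have hε : ε < ω ^ β := lt_of_add_lt_add_left h2
    rw [Ordinal.add_sub_add_cancel]
    conv_lhs => rw [← Ordinal.add_omega0_opow hε]
    exact Ordinal.add_sub_cancel _ _
  have hpos : ∀ β : Ordinal.{v}, 0 < ω ^ β := fun β => Ordinal.opow_pos β Ordinal.omega0_pos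
  have l1 : γ < γ + ω ^ β := lt_add_of_pos_right γ (hpos β)
  have l2 : γ' < γ + ω ^ β := h ▸ lt_add_of_pos_right γ' (hpos β')
  have e1 := key (le_max_left γ γ') (max_lt l1 l2)
  have e2 := key (le_max_right γ γ') (h ▸ max_lt l1 l2 : max γ γ' < γ' + ω ^ β')
  rw [h, e2] at e1
  exact (Ordinal.opow_right_inj Ordinal.one_lt_omega0).1 e1.symm

theorem ell_zero : ell (0 : Ordinal.{v}) = 0 := by
  have : {β : Ordinal.{v} | ∃ γ : Ordinal.{v}, 0 = γ + ω ^ β} = ∅ := by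
    ext β
    simp only [Set.mem_ofPred_eq, Set.mem_empty_iff_false, iff_false, not_exists]
    intro γ hγ
    have h1 : 0 < ω ^ β := Ordinal.opow_pos β Ordinal.omega0_pos
    exact absurd (lt_of_lt_of_le h1 (le_add_self : ω ^ β ≤ γ + ω ^ β)) (by simp [← hγ])
  unfold ell
  rw [this, Ordinal.sInf_empty]

theorem ell_add_opow (γ β : Ordinal.{v}) : ell (γ + ω ^ β) = β := by
  have : {β' : Ordinal.{v} | ∃ γ', γ + ω ^ β = γ' + ω ^ β'} = {β} := by
    ext β'
    exact ⟨fun ⟨_, h⟩ => (add_opow_inj h).symm, fun h => ⟨γ, by rw [Set.mem_singleton_iff.1 h]⟩⟩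
  unfold ell
  rw [this, csInf_singleton]

theorem exists_eq_add_opow_ell {α : Ordinal.{v}} (hα : α ≠ 0) : ∃ γ, α = γ + ω ^ ell α := by
  have : ∃ γ β : Ordinal.{v}, α = γ + ω ^ β := by
    induction α using WellFoundedLT.induction with
    | ind α ih =>
      have hle := Ordinal.opow_log_le_self ω hα
      set b := Ordinal.log ω α
      have hadd : ω ^ b + (α - ω ^ b) = α := Ordinal.add_sub_cancel_of_le hle
      by_cases h0 : α - ω ^ b = 0
      · exact ⟨0, b, by rw [zero_add, ← hadd, h0, add_zero]⟩
      · rcases lt_or_eq_of_le (Ordinal.sub_le_self α (ω ^ b)) with hlt | heq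
        · obtain ⟨γ, β, h⟩ := ih _ hlt h0
          exact ⟨ω ^ b + γ, β, by rw [add_assoc, ← h, hadd]⟩
        · -- impossible: then `ω ^ b * ω ≤ α < ω ^ (b + 1)`
          exfalso
          rw [heq] at hadd
          have h1 : ω ^ b * ω ≤ α := Ordinal.add_eq_right_iff_mul_omega0_le.1 hadd
          have h2 : α < ω ^ Order.succ b := Ordinal.lt_opow_succ_log_self Ordinal.one_lt_omega0 α
          rw [Ordinal.opow_succ] at h2
          exact absurd h1 (not_le.2 h2)
  obtain ⟨γ, β, h⟩ := this
  refine ⟨γ, ?_⟩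
  conv_rhs => rw [h, ell_add_opow]
  exact h

/-- Icard's topology `ϑ_n`, on the class of all ordinals: it is generated by the interval topology
together with all sets `{α | ℓ^m(α) > β}` for `m ≤ n`. On a set of ordinals we use the subspace
topology. -/
abbrev icard (n : ℕ) : TopologicalSpace Ordinal.{v} :=
  TopologicalSpace.generateFrom
    ({U | IsOpen U} ∪ {U | ∃ m ≤ n, ∃ β : Ordinal.{v}, U = {α | β < ell^[m] α}})

/-- The topology `ϑ_n` on the interval `[1, lam]`. -/
abbrev icardIcc (lam : Ordinal.{v}) (n : ℕ) : TopologicalSpace (Set.Icc 1 lam) :=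
  (icard n).induced Subtype.val

/-! ### Transfinite binary words -/

/-- A transfinite binary word of length `len`, given by the set of positions that carry a `1`. -/
@[ext]
structure Word where
  len : Ordinal.{v}
  ones : Set Ordinal.{v}
  lt_len : ∀ x ∈ ones, x < len

/-- The word of length `Ω` associated with the subset `X ∩ Ω` of `Ω`. -/
def Word.ofSet (Ω : Ordinal.{v}) (X : Set Ordinal.{v}) : Word.{v} where
  len := Ω
  ones := X ∩ Set.Iio Ω
  lt_len := fun _ hx => hx.2

/-- Concatenation `A B`. -/
def Word.concat (A B : Word.{v}) : Word.{v} where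
  len := A.len + B.len
  ones := A.ones ∪ (fun x => A.len + x) '' B.ones
  lt_len := by
    rintro x (hx | ⟨y, hy, rfl⟩)
    · exact (A.lt_len x hx).trans_le le_self_add
    · exact add_lt_add_right (B.lt_len y hy) A.len

/-- Iteration `A ^ β`: the concatenation of `β` copies of `A`. The recursive equations are
`iter_zero`, `iter_succ`, `iter_limit_len` and `iter_limit_ones`. -/
def Word.iter (A : Word.{v}) (β : Ordinal.{v}) : Word.{v} where
  len := A.len * β
  ones := {x | ∃ ξ < β, ∃ δ ∈ A.ones, x = A.len * ξ + δ}
  lt_len := by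
    rintro x ⟨ξ, hξ, δ, hδ, rfl⟩
    calc A.len * ξ + δ < A.len * ξ + A.len := add_lt_add_right (A.lt_len δ hδ) _
      _ = A.len * Order.succ ξ := (Ordinal.mul_succ _ _).symm
      _ ≤ A.len * β := mul_le_mul_right (Order.succ_le_of_lt hξ) _

theorem Word.iter_zero (A : Word.{v}) : A.iter 0 = ⟨0, ∅, by simp⟩ := by
  ext x
  · simp [Word.iter]
  · simp [Word.iter]

theorem Word.iter_succ (A : Word.{v}) (β : Ordinal.{v}) :
    A.iter (Order.succ β) = (A.iter β).concat A := by
  ext x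
  · simp [Word.iter, Word.concat, mul_add]
  · constructor
    · rintro ⟨ξ, hξ, δ, hδ, rfl⟩
      rcases lt_or_eq_of_le (Order.lt_succ_iff.1 hξ) with h | rfl
      · exact Or.inl ⟨ξ, h, δ, hδ, rfl⟩
      · exact Or.inr ⟨δ, hδ, rfl⟩
    · rintro (⟨ξ, hξ, δ, hδ, rfl⟩ | ⟨δ, hδ, rfl⟩)
      · exact ⟨ξ, hξ.trans (Order.lt_succ β), δ, hδ, rfl⟩
      · exact ⟨β, Order.lt_succ β, δ, hδ, rfl⟩

theorem Word.iter_limit_len (A : Word.{v}) {β : Ordinal.{v}} (hβ : Order.IsSuccLimit β) :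
    IsLUB ((fun ξ => (A.iter ξ).len) '' Set.Iio β) (A.iter β).len := by
  refine ⟨?_, fun b hb => (Ordinal.mul_le_iff_of_isSuccLimit hβ).2 fun ξ hξ => hb ⟨ξ, hξ, rfl⟩⟩
  rintro _ ⟨ξ, hξ, rfl⟩
  exact mul_le_mul_right (le_of_lt hξ) A.len

theorem Word.iter_limit_ones (A : Word.{v}) {β : Ordinal.{v}} (hβ : Order.IsSuccLimit β) :
    (A.iter β).ones = ⋃ ξ < β, (A.iter ξ).ones := by
  ext x
  simp only [Set.mem_iUnion, exists_prop]
  constructor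
  · rintro ⟨ξ, hξ, δ, hδ, rfl⟩
    exact ⟨Order.succ ξ, hβ.succ_lt hξ, ξ, Order.lt_succ ξ, δ, hδ, rfl⟩
  · rintro ⟨η, hη, ξ, hξ, δ, hδ, rfl⟩
    exact ⟨ξ, hξ.trans hη, δ, hδ, rfl⟩

/-- `X` is periodic: `X = A ^ lam` for some nonempty word `A` and some limit ordinal `lam`. -/
def Word.IsPeriodic (X : Word.{v}) : Prop :=
  ∃ (A : Word.{v}) (lam : Ordinal.{v}), A.len ≠ 0 ∧ Order.IsSuccLimit lam ∧ X = A.iter lam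

/-- `X` is ultimately periodic: `X = B Y` with `Y` periodic. -/
def Word.IsUltimatelyPeriodic (X : Word.{v}) : Prop :=
  ∃ B Y : Word.{v}, Y.IsPeriodic ∧ X = B.concat Y

/-! ### Hereditarily periodic and `n`-periodic sets -/

/-- `X` is hereditarily periodic in `Ω`: it is ultimately periodic in each limit ordinal `β ≤ Ω`. -/
def IsHereditarilyPeriodic (Ω : Ordinal.{v}) (X : Set Ordinal.{v}) : Prop :=
  ∀ β ≤ Ω, Order.IsSuccLimit β → (Word.ofSet β X).IsUltimatelyPeriodic

/-- `𝓗_0(Ω)`: the hereditarily periodic subsets of `Ω`. -/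
def periodicBase (Ω : Ordinal.{v}) : Set (Set Ordinal.{v}) :=
  {X | X ⊆ Set.Iio Ω ∧ IsHereditarilyPeriodic Ω X}

/-- `𝓥_n(Ω)`: `𝓥_0(Ω) = 𝓗_0(Ω)` and
`𝓥_{n+1}(Ω) = {B ∩ ℓ⁻¹(A) | B ∈ 𝓗_0(Ω), A ∈ 𝓥_n(Ω)}`. -/
def periodicGen (Ω : Ordinal.{v}) : ℕ → Set (Set Ordinal.{v})
  | 0 => periodicBase Ω
  | n + 1 => {X | ∃ B ∈ periodicBase Ω, ∃ A ∈ periodicGen Ω n, X = B ∩ ell ⁻¹' A}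

/-- `𝓗_n(Ω)`: the `n`-periodic subsets of `Ω`, i.e. the finite unions of members of `𝓥_n(Ω)`. -/
def nPeriodic (n : ℕ) (Ω : Ordinal.{v}) : Set (Set Ordinal.{v}) :=
  {X | ∃ F : Set (Set Ordinal.{v}), F.Finite ∧ F ⊆ periodicGen Ω n ∧ X = ⋃₀ F}

/-- The algebra `𝓗_n` on the interval `[1, lam]`: the traces on `[1, lam]` of the `n`-periodic
subsets of the ordinal `lam + 1 = [0, lam]`. -/
def nPeriodicIcc (n : ℕ) (lam : Ordinal.{v}) : Set (Set (Set.Icc 1 lam)) :=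
  {S | ∃ A ∈ nPeriodic n (lam + 1), S = Subtype.val ⁻¹' A}

/-! ### `J_n`-trees

A frame `(W, R_0, …, R_n)` is represented by a sequence `R : ℕ → W → W → Prop` of relations
with `R_i` empty for `i > n`. -/

/-- The relations of `𝓦⁺ = (W, ∅, R_0, R_1, …)`. -/
def plusRel {W : Type u} (R : ℕ → W → W → Prop) : ℕ → W → W → Prop
  | 0, _, _ => False
  | i + 1, x, y => R i x y

/-- The disjoint sum of `𝓥⁺` and the frames `𝓦_i`, with `R_0` extended by all pairs `(v, w)` for
`v ∈ V` and `w` in one of the `W_i`. -/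
def graftRel {V : Type u} {k : ℕ} {W : Fin k → Type u} (RV : ℕ → V → V → Prop)
    (RW : ∀ i, ℕ → W i → W i → Prop) :
    ℕ → (V ⊕ Σ i, W i) → (V ⊕ Σ i, W i) → Prop
  | j, Sum.inl v, Sum.inl v' => plusRel RV j v v'
  | j, Sum.inl _, Sum.inr _ => j = 0
  | _, Sum.inr _, Sum.inl _ => False
  | j, Sum.inr p, Sum.inr q => ∃ i x y, p = ⟨i, x⟩ ∧ q = ⟨i, y⟩ ∧ RW i j x y

/-- `(W, R)` is an irreflexive transitive tree: a rooted strict order in which the predecessors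
of each point form a chain. -/
def IsTransTree {W : Type u} (R : W → W → Prop) : Prop :=
  (∀ x, ¬ R x x) ∧ (∀ x y z, R x y → R y z → R x z) ∧
  (∃ r, ∀ x, x ≠ r → R r x) ∧ (∀ x y z, R x z → R y z → x = y ∨ R x y ∨ R y x)

/-- `IsJTree n W R`: the frame `(W, R_0, …, R_n)` is a `J_n`-tree. The class is closed under
isomorphism, since disjoint sums are only meant up to isomorphism. -/
inductive IsJTree : ℕ → (W : Type u) → (ℕ → W → W → Prop) → Prop
  | base (W : Type u) (R : ℕ → W → W → Prop) (hfin : Finite W) (htree : IsTransTree (R 0))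
      (hempty : ∀ i x y, 0 < i → ¬ R i x y) : IsJTree 0 W R
  | plus (n : ℕ) (W : Type u) (R : ℕ → W → W → Prop) (h : IsJTree n W R) :
      IsJTree (n + 1) W (plusRel R)
  | graft (n : ℕ) (V : Type u) (RV : ℕ → V → V → Prop) (k : ℕ) (W : Fin k → Type u)
      (RW : ∀ i, ℕ → W i → W i → Prop) (hV : IsJTree n V RV)
      (hW : ∀ i, IsJTree (n + 1) (W i) (RW i)) :
      IsJTree (n + 1) (V ⊕ Σ i, W i) (graftRel RV RW)
  | iso (n : ℕ) (W W' : Type u) (R : ℕ → W → W → Prop) (R' : ℕ → W' → W' → Prop) (e : W ≃ W')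
      (he : ∀ i x y, R i x y ↔ R' i (e x) (e y)) (h : IsJTree n W R) : IsJTree n W' R'

/-- `R*_k = R_k ∪ ⋯ ∪ R_n`. -/
def RStar {T : Type u} (n : ℕ) (R : ℕ → T → T → Prop) (k : ℕ) (x y : T) : Prop :=
  ∃ i, k ≤ i ∧ i ≤ n ∧ R i x y

/-- `w` is a hereditary `k`-root: an `R*_k`-minimal node. -/
def IsHereditaryRoot {T : Type u} (n : ℕ) (R : ℕ → T → T → Prop) (k : ℕ) (w : T) : Prop :=
  ∀ v, ¬ RStar n R k v w

/-- The topology on `T` whose open sets are the upsets of the relation `r`. -/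
abbrev upsetTop {T : Type u} (r : T → T → Prop) : TopologicalSpace T where
  IsOpen U := ∀ x ∈ U, ∀ y, r x y → y ∈ U
  isOpen_univ := fun _ _ _ _ => Set.mem_univ _
  isOpen_inter := fun _ _ hs ht x hx y hxy => ⟨hs x hx.1 y hxy, ht x hx.2 y hxy⟩
  isOpen_sUnion := fun _ h x ⟨U, hU, hx⟩ y hxy => ⟨U, hU, h U hU x hx y hxy⟩

/-! ### `d`-maps and `J_n`-morphisms -/

/-- `f` is a `d`-map: continuous, open, and with discrete fibres. -/
def IsDMap {X : Type*} {Y : Type*} (τ : TopologicalSpace X) (σ : TopologicalSpace Y)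
    (f : X → Y) : Prop :=
  Continuous[τ, σ] f ∧ @IsOpenMap X Y τ σ f ∧ ∀ y, @IsDiscrete X τ (f ⁻¹' {y})

/-- `f` is a `J_n`-morphism from the polytopological space `(X, τ_0, …, τ_n)` to the frame
`(T, R_0, …, R_n)`. -/
structure IsJMorphism {X : Type*} {T : Type u} (n : ℕ) (τ : ℕ → TopologicalSpace X)
    (R : ℕ → T → T → Prop) (f : X → T) : Prop where
  dMap : IsDMap (τ n) (upsetTop (R n)) f
  openMap : ∀ k ≤ n, @IsOpenMap X T (τ k) (upsetTop (R k)) f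
  open_preimage : ∀ k < n, ∀ w, IsHereditaryRoot n R (k + 1) w →
    IsOpen[τ k] (f ⁻¹' {u | RStar n R k w u}) ∧
    IsOpen[τ k] (f ⁻¹' ({u | RStar n R k w u} ∪ {w}))
  discrete_preimage : ∀ k < n, ∀ w, IsHereditaryRoot n R (k + 1) w →
    @IsDiscrete X (τ k) (f ⁻¹' {w})

/-- `f` is algebra preserving with respect to the family `𝓐` of admissible subsets of `X`,
all subsets of `T` being admissible. -/
def IsAlgebraPreserving {X : Type*} {T : Type u} (𝓐 : Set (Set X)) (f : X → T) : Prop :=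
  ∀ A : Set T, f ⁻¹' A ∈ 𝓐

/-- The ordinals `ω_0 = 1`, `ω_{k+1} = ω ^ ω_k`. -/
noncomputable def tower : ℕ → Ordinal.{v}
  | 0 => 1
  | k + 1 => ω ^ tower k

end OrdGLP

/-!
The covering map is built by induction on the `J_n`-tree, together with the information that exactly
one point of `[1, lam]`, namely `lam`, lies over the root of the tree. Everything is done with total
functions `f : Ordinal → T`, and the conditions on a `J_n`-morphism are imposed point by point
(`IsLocalJ`), in terms of the neighbourhood filters `nb k x` of `ϑ_k`. Three facts about these
filters are used: `ϑ_{k+1}` is the join of the interval topology and the pullback of `ϑ_k` along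
`ℓ` (`icard_succ`), left translations by an ordinal are local homeomorphisms of all `ϑ_k`
(`map_add_nb`), and `ℓ` is continuous and open from `ϑ_{k+1}` to `ϑ_k` (`map_ell_nb`).

*Disjoint unions.* Covers of two upward closed parts of a frame by `[1, lam]` and `[1, lam']` are
concatenated to a cover of the union by `[1, lam + lam']` (`IsCover.union`).

*Repetition.* A cover of `S` by `[1, κ]`, `κ ≠ 0`, is repeated on all blocks
`(κ * ξ, κ * ξ + κ]`. With `c = log κ + 1` the blocks consist exactly of the positive ordinals of
rank `ℓ x < c`, and the remaining points `κ * ξ`, `ξ` a limit, those of rank at least `c`, are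
limits of complete blocks (`IsCover.isFilling`). If `S` is empty, `c = 0` serves.

*Trees.* For a single relation, a filling of the set of successors of `w` is completed by
mapping `ω ^ c` to `w` (`IsFilling.exists_isPointedCover`).

*Grafting.* Let `[1, 1 + μ']` cover `V`, and fill the points of rank below `c` by the grafted frames.
The points of rank at least `c` in `[1, ω ^ (c + μ')]` are mapped to `V` by composing the cover of
`V` with `x ↦ 1 + (ℓ x - c)`, a continuous open map from `ϑ_{k+1}` to `ϑ_k`
(`IsPointedCover.graft`). The operation `𝓦⁺` is the case in which no frame is grafted, so `c = 0`.

The algebra is preserved because hereditarily periodic classes are closed under truncation,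
translation, deletion of the first letter and repetition of blocks; at the upper levels the points
of rank at least `c` are cut off by a truncation inside `ℓ ⁻¹`.
-/

namespace OrdGLP

open Ordinal Order Filter

/-! ### Arithmetic of `ℓ` -/

theorem ell_add {δ : Ordinal.{v}} (γ : Ordinal.{v}) (hδ : δ ≠ 0) : ell (γ + δ) = ell δ := by
  obtain ⟨ε, hε⟩ := exists_eq_add_opow_ell hδ
  conv_lhs => rw [hε, ← add_assoc, ell_add_opow]

theorem ell_one : ell (1 : Ordinal.{v}) = 0 := by
  simpa using ell_add_opow (0 : Ordinal.{v}) 0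

theorem ell_opow (β : Ordinal.{v}) : ell (ω ^ β) = β := by
  simpa using ell_add_opow 0 β

theorem opow_ell_le {α : Ordinal.{v}} (hα : α ≠ 0) : ω ^ ell α ≤ α := by
  obtain ⟨γ, h⟩ := exists_eq_add_opow_ell hα
  conv_rhs => rw [h]
  exact le_add_self

theorem ell_le_self (α : Ordinal.{v}) : ell α ≤ α := by
  rcases eq_or_ne α 0 with rfl | h
  · rw [ell_zero]
  · exact (right_le_opow _ one_lt_omega0).trans (opow_ell_le h)

theorem ell_le_log {δ κ : Ordinal.{v}} (hδ : δ ≠ 0) (h : δ ≤ κ) : ell δ ≤ log ω κ :=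
  (opow_le_iff_le_log one_lt_omega0 (fun h0 => hδ (nonpos_iff_eq_zero.1 (h0 ▸ h)))).1
    ((opow_ell_le hδ).trans h)

theorem ell_le_of_le_opow {x e : Ordinal.{v}} (hx : x ≠ 0) (h : x ≤ ω ^ e) : ell x ≤ e :=
  (opow_le_opow_iff_right one_lt_omega0).1 ((opow_ell_le hx).trans h)

theorem ell_lt_of_lt_opow {x e : Ordinal.{v}} (hx : x ≠ 0) (h : x < ω ^ e) : ell x < e :=
  (opow_lt_opow_iff_right one_lt_omega0).1 ((opow_ell_le hx).trans_lt h)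

/-- Strictly below `x`, and close to it, all points have smaller rank. -/
theorem exists_forall_ell_lt {x : Ordinal.{v}} (hx : x ≠ 0) :
    ∃ γ < x, ∀ z, γ < z → z < x → ell z < ell x := by
  obtain ⟨γ, h⟩ := exists_eq_add_opow_ell hx
  refine ⟨γ, ?_, fun z h1 h2 => ?_⟩
  · conv_rhs => rw [h]
    exact lt_add_of_pos_right γ (opow_pos _ omega0_pos)
  · obtain ⟨δ, rfl⟩ : ∃ δ, z = γ + δ := ⟨z - γ, (Ordinal.add_sub_cancel_of_le h1.le).symm⟩
    have hδ : δ ≠ 0 := by rintro rfl; simp at h1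
    rw [ell_add γ hδ]
    rw [h] at h2
    exact ell_lt_of_lt_opow hδ (lt_of_add_lt_add_left h2)

/-- All smaller ranks are attained arbitrarily close below `x`. -/
theorem exists_ell_eq {x γ y : Ordinal.{v}} (hγ : γ < x) (hy : y ≤ ell x) :
    ∃ z, γ < z ∧ z ≤ x ∧ ell z = y := by
  rcases eq_or_lt_of_le hy with rfl | hy
  · exact ⟨x, hγ, le_rfl, rfl⟩
  have hx : x ≠ 0 := (pos_of_gt hγ).ne'
  obtain ⟨γ₀, h⟩ := exists_eq_add_opow_ell hx
  have h0 : γ₀ < x := by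
    conv_rhs => rw [h]
    exact lt_add_of_pos_right γ₀ (opow_pos _ omega0_pos)
  obtain ⟨δ, hδ⟩ : ∃ δ, max γ γ₀ = γ₀ + δ :=
    ⟨max γ γ₀ - γ₀, (Ordinal.add_sub_cancel_of_le (le_max_right _ _)).symm⟩
  have hδlt : δ < ω ^ ell x := by
    have : γ₀ + δ < γ₀ + ω ^ ell x := by rw [← hδ, ← h]; exact max_lt hγ h0
    exact lt_of_add_lt_add_left this
  refine ⟨max γ γ₀ + ω ^ y, (le_max_left _ _).trans_lt
    (lt_add_of_pos_right _ (opow_pos _ omega0_pos)), ?_, ell_add_opow _ _⟩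
  conv_rhs => rw [h]
  rw [hδ, add_assoc]
  exact add_le_add_right (isPrincipal_add_omega0_opow _ hδlt
    ((opow_lt_opow_iff_right one_lt_omega0).2 hy)).le _

theorem mul_omega0_eq {κ : Ordinal.{v}} (hκ : κ ≠ 0) : κ * ω = ω ^ (log ω κ + 1) := by
  apply le_antisymm
  · obtain ⟨m, hm⟩ := lt_omega0_opow_succ.1 (lt_opow_succ_log_self one_lt_omega0 κ)
    have hm0 : 0 < m := by
      rcases Nat.eq_zero_or_pos m with rfl | h
      · simp at hm
      · exact h
    calc κ * ω ≤ ω ^ log ω κ * m * ω := mul_le_mul_left hm.le _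
      _ = ω ^ (log ω κ + 1) := by
        rw [mul_assoc, natCast_mul_omega0 hm0, opow_add, opow_one]
  · rw [opow_add, opow_one]
    exact mul_le_mul_left (opow_log_le_self ω hκ) _

theorem log_lt_ell_mul {κ ξ : Ordinal.{v}} (hκ : κ ≠ 0) (hξ : IsSuccLimit ξ) :
    log ω κ + 1 ≤ ell (κ * ξ) := by
  have hξ0 : ξ ≠ 0 := (isSuccLimit_iff.1 hξ).1
  obtain ⟨γ, h⟩ := exists_eq_add_opow_ell hξ0
  have he : ell ξ ≠ 0 := by
    intro h0
    rw [h0, opow_zero] at h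
    rw [h, ← succ_eq_add_one] at hξ
    exact not_isSuccLimit_succ γ hξ
  obtain ⟨e, he⟩ : ∃ e, ell ξ = 1 + e :=
    ⟨ell ξ - 1, (Ordinal.add_sub_cancel_of_le (one_le_iff_ne_zero.2 he)).symm⟩
  rw [h, mul_add, he, opow_add, opow_one, ← mul_assoc, mul_omega0_eq hκ, ← opow_add, ell_add_opow]
  exact le_self_add

/-! ### Neighbourhood filters of Icard's topologies -/

/-- The neighbourhood filter of `x` in `ϑ_k`. -/
def nb (k : ℕ) (x : Ordinal.{v}) : Filter Ordinal.{v} := @nhds _ (icard k) x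

theorem icard_zero : icard.{v} 0 = (inferInstance : TopologicalSpace Ordinal.{v}) := by
  apply le_antisymm
  · intro U hU
    exact TopologicalSpace.isOpen_generateFrom_of_mem (Or.inl hU)
  · refine le_generateFrom ?_
    rintro U (hU | ⟨m, hm, β, rfl⟩)
    · exact hU
    · obtain rfl := Nat.le_zero.1 hm
      exact isOpen_Ioi

theorem isOpen_ell_lt (b : Ordinal.{v}) : IsOpen {α : Ordinal.{v} | ell α < b} := by
  rw [SuccOrder.isOpen_iff]
  intro x hx hl
  obtain ⟨γ, h1, h2⟩ := exists_forall_ell_lt (isSuccLimit_iff.1 hl).1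
  exact ⟨γ, h1, fun z hz => (h2 z hz.1 hz.2).trans hx⟩

/-- `ϑ_{k+1}` is generated by the interval topology and the topology `ϑ_k` pulled back along `ℓ`. -/
theorem icard_succ (k : ℕ) : icard.{v} (k + 1) = icard 0 ⊓ (icard k).induced ell := by
  apply le_antisymm
  · refine le_inf ?_ ?_
    · rw [icard_zero]
      exact fun U hU => TopologicalSpace.isOpen_generateFrom_of_mem (Or.inl hU)
    · rw [induced_generateFrom_eq]
      refine le_generateFrom ?_
      rintro _ ⟨U, hU | ⟨m, hm, β, rfl⟩, rfl⟩
      · have h : @Continuous _ _ (icard (k + 1)) _ ell := by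
          rw [OrderTopology.topology_eq_generate_intervals (α := Ordinal.{v}),
            continuous_generateFrom_iff]
          rintro _ ⟨b, rfl | rfl⟩
          · exact TopologicalSpace.isOpen_generateFrom_of_mem (Or.inr ⟨1, by omega, b, rfl⟩)
          · exact TopologicalSpace.isOpen_generateFrom_of_mem (Or.inl (isOpen_ell_lt b))
        exact @IsOpen.preimage _ _ (icard (k + 1)) _ _ h U hU
      · exact TopologicalSpace.isOpen_generateFrom_of_mem (Or.inr ⟨m + 1, by omega, β, rfl⟩)
  · refine le_generateFrom ?_
    rintro U (hU | ⟨m, hm, β, rfl⟩)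
    · have : IsOpen[icard 0] U := by rw [icard_zero]; exact hU
      exact (inf_le_left : icard 0 ⊓ (icard k).induced ell ≤ _) _ this
    · rcases m with _ | m
      · have : IsOpen[icard 0] {α : Ordinal.{v} | β < ell^[0] α} := by
          rw [icard_zero]; exact isOpen_Ioi
        exact (inf_le_left : icard 0 ⊓ (icard k).induced ell ≤ _) _ this
      · have : IsOpen[(icard k).induced ell] {α : Ordinal.{v} | β < ell^[m + 1] α} :=
          ⟨{α | β < ell^[m] α},
            TopologicalSpace.isOpen_generateFrom_of_mem (Or.inr ⟨m, by omega, β, rfl⟩), rfl⟩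
        exact (inf_le_right : icard 0 ⊓ (icard k).induced ell ≤ _) _ this

theorem nb_zero (x : Ordinal.{v}) : nb 0 x = 𝓝 x := by
  rw [nb, icard_zero]

theorem nb_succ (k : ℕ) (x : Ordinal.{v}) :
    nb (k + 1) x = nb 0 x ⊓ comap ell (nb k (ell x)) := by
  rw [nb, icard_succ]
  exact (nhds_inf (t₁ := icard 0) (t₂ := (icard k).induced ell)).trans
    (congrArg (_ ⊓ ·) (@nhds_induced _ _ (icard k) ell x))

theorem nb_le_zero (k : ℕ) (x : Ordinal.{v}) : nb k x ≤ nb 0 x := by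
  rcases k with _ | k
  · exact le_rfl
  · rw [nb_succ]; exact inf_le_left

theorem pure_le_nb (k : ℕ) (x : Ordinal.{v}) : pure x ≤ nb k x :=
  @pure_le_nhds _ (icard k) x

theorem hasBasis_nb_zero {x : Ordinal.{v}} (hx : x ≠ 0) :
    (nb 0 x).HasBasis (· < x) (Set.Ioc · x) := by
  rw [nb_zero]
  exact SuccOrder.hasBasis_nhds_Ioc_of_exists_lt ⟨0, pos_iff_ne_zero.2 hx⟩

theorem Ioc_mem_nb {x γ : Ordinal.{v}} (k : ℕ) (h : γ < x) : Set.Ioc γ x ∈ nb k x :=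
  nb_le_zero k x ((hasBasis_nb_zero (pos_of_gt h).ne').mem_of_mem h)

theorem Iic_mem_nb (k : ℕ) (x : Ordinal.{v}) : Set.Iic x ∈ nb k x := by
  refine nb_le_zero k x ?_
  rw [nb_zero]
  have : Set.Iic x = Set.Iio (succ x) := by ext; simp
  rw [this]
  exact Iio_mem_nhds (lt_succ x)

theorem nb_eq_pure {x : Ordinal.{v}} (k : ℕ) (hx : ¬ IsSuccLimit x) : nb k x = pure x := by
  refine le_antisymm ?_ (pure_le_nb k x)
  rw [← SuccOrder.nhds_eq_pure.2 hx, ← nb_zero]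
  exact nb_le_zero k x

/-- Left translation by `γ` is a local homeomorphism of every `ϑ_k` at positive ordinals. -/
theorem map_add_nb (k : ℕ) (γ : Ordinal.{v}) {δ : Ordinal.{v}} (hδ : δ ≠ 0) :
    map (γ + ·) (nb k δ) = nb k (γ + δ) := by
  have h0 : map (γ + ·) (nb 0 δ) = nb 0 (γ + δ) := by
    have hne : γ + δ ≠ 0 := fun h => hδ (nonpos_iff_eq_zero.1 (h ▸ (le_add_self : δ ≤ γ + δ)))
    refine ((hasBasis_nb_zero hδ).map _).ext (hasBasis_nb_zero hne) ?_ ?_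
    · intro a ha
      refine ⟨γ + a, add_lt_add_right ha γ, ?_⟩
      rintro z ⟨hz1, hz2⟩
      obtain ⟨t, rfl⟩ : ∃ t, z = γ + t :=
        ⟨z - γ, (Ordinal.add_sub_cancel_of_le (le_self_add.trans hz1.le)).symm⟩
      exact ⟨t, ⟨lt_of_add_lt_add_left hz1, le_of_add_le_add_left hz2⟩, rfl⟩
    · intro a ha
      refine ⟨a - γ, (sub_lt_of_lt_add ha (pos_iff_ne_zero.2 hδ)), ?_⟩
      rintro _ ⟨t, ⟨ht1, ht2⟩, rfl⟩
      refine ⟨?_, add_le_add_right ht2 γ⟩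
      by_contra hcon
      exact absurd ht1 (not_lt.2 (le_sub_of_add_le (not_lt.1 hcon)))
  rcases k with _ | k
  · exact h0
  · rw [nb_succ, nb_succ, ell_add γ hδ, ← h0, ← Filter.push_pull, comap_comap]
    congr 1
    -- on the positive ordinals `ℓ (γ + t) = ℓ t`
    have hpos : Set.Ioi 0 ∈ nb 0 δ :=
      mem_of_superset (Ioc_mem_nb 0 (pos_iff_ne_zero.2 hδ)) fun t ht => ht.1
    ext s
    simp only [mem_inf_iff_superset, mem_comap]
    constructor
    · rintro ⟨t₁, h₁, t₂, ⟨u, hu, hut⟩, hs⟩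
      refine ⟨t₁ ∩ Set.Ioi 0, inter_mem h₁ hpos, _, ⟨u, hu, subset_rfl⟩, ?_⟩
      rintro z ⟨⟨hz1, hz2⟩, hz3⟩
      refine hs ⟨hz1, hut ?_⟩
      simp only [Set.mem_preimage, Function.comp] at hz3 ⊢
      rwa [ell_add γ (ne_of_gt hz2)] at hz3
    · rintro ⟨t₁, h₁, t₂, ⟨u, hu, hut⟩, hs⟩
      refine ⟨t₁ ∩ Set.Ioi 0, inter_mem h₁ hpos, _, ⟨u, hu, subset_rfl⟩, ?_⟩
      rintro z ⟨⟨hz1, hz2⟩, hz3⟩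
      refine hs ⟨hz1, hut ?_⟩
      simp only [Set.mem_preimage, Function.comp] at hz3 ⊢
      rwa [ell_add γ (ne_of_gt hz2)]

/-- `ℓ` is continuous and open from `ϑ_{k+1}` to `ϑ_k`. -/
theorem map_ell_nb (k : ℕ) {x : Ordinal.{v}} (hx : x ≠ 0) :
    map ell (nb (k + 1) x) = nb k (ell x) := by
  refine le_antisymm ?_ fun s hs => ?_
  · rw [nb_succ]
    exact (map_mono inf_le_right).trans map_comap_le
  · rw [mem_map, nb_succ, mem_inf_iff_superset] at hs
    obtain ⟨t₁, h₁, t₂, ⟨u, hu, hut⟩, hs⟩ := hs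
    obtain ⟨γ, hγ, hγt⟩ := (hasBasis_nb_zero hx).mem_iff.1 h₁
    refine mem_of_superset (inter_mem hu (Iic_mem_nb k _)) ?_
    rintro y ⟨hy1, hy2⟩
    obtain ⟨z, hz1, hz2, rfl⟩ := exists_ell_eq hγ hy2
    exact hs ⟨hγt ⟨hz1, hz2⟩, hut hy1⟩

theorem eventually_ell_lt (k : ℕ) {x : Ordinal.{v}} (hx : x ≠ 0) :
    ∀ᶠ z in nb k x, z ≠ x → ell z < ell x := by
  obtain ⟨γ, h1, h2⟩ := exists_forall_ell_lt hx
  filter_upwards [Ioc_mem_nb k h1] with z hz hzx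
  exact h2 z hz.1 (lt_of_le_of_ne hz.2 hzx)

/-! ### Shifting ranks -/

/-- The order isomorphism from `[c, ∞)` onto `[1, ∞)`. -/
noncomputable def shift (c y : Ordinal.{v}) : Ordinal.{v} := 1 + (y - c)

theorem shift_zero (y : Ordinal.{v}) : shift 0 y = 1 + y := by simp [shift]

theorem shift_ne_zero (c y : Ordinal.{v}) : shift c y ≠ 0 := by
  rw [shift, ← pos_iff_ne_zero]
  exact zero_lt_one.trans_le le_self_add

theorem shift_add (c t : Ordinal.{v}) : shift c (c + t) = 1 + t := by simp [shift]

theorem shift_succ {ν y : Ordinal.{v}} (h : ν + 1 ≤ y) : y = ν + shift (ν + 1) y := by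
  rw [shift, ← add_assoc, Ordinal.add_sub_cancel_of_le h]

theorem shift_inj {c y z : Ordinal.{v}} (hy : c ≤ y) (hz : c ≤ z) (h : shift c y = shift c z) :
    y = z := by
  have : y - c = z - c := add_left_cancel h
  rw [← Ordinal.add_sub_cancel_of_le hy, this, Ordinal.add_sub_cancel_of_le hz]

theorem map_shift_nb (k : ℕ) {c y : Ordinal.{v}} (hc : c = 0 ∨ ∃ ν, c = ν + 1) (hy : c ≤ y) :
    map (shift c) (nb k y) = nb k (shift c y) := by
  rcases hc with rfl | ⟨ν, rfl⟩
  · have : shift (0 : Ordinal.{v}) = (1 + ·) := funext shift_zero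
    rcases eq_or_ne y 0 with rfl | h
    · have h1 : ¬ IsSuccLimit (1 : Ordinal.{v}) := by
        rw [← zero_add (1 : Ordinal.{v}), ← succ_eq_add_one]; exact not_isSuccLimit_succ 0
      rw [nb_eq_pure k not_isSuccLimit_zero, map_pure, shift_zero, add_zero, nb_eq_pure k h1]
    · rw [this]
      exact map_add_nb k 1 h
  · have hev : ∀ᶠ z in nb k y, ν + 1 ≤ z := by
      have : ν < y := (lt_succ ν).trans_le (by rwa [succ_eq_add_one])
      filter_upwards [Ioc_mem_nb k this] with z hz
      rw [← succ_eq_add_one]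
      exact succ_le_of_lt hz.1
    have hinj : Function.Injective (ν + · : Ordinal.{v} → Ordinal.{v}) :=
      fun a b h => add_left_cancel h
    apply map_injective hinj
    rw [map_add_nb k ν (shift_ne_zero _ _), ← shift_succ hy, map_map]
    conv_rhs => rw [← map_id (f := nb k y)]
    apply Filter.map_congr
    filter_upwards [hev] with z hz
    exact (shift_succ hz).symm

theorem ell_shift {c y : Ordinal.{v}} (hc : c = 0 ∨ ∃ ν, c = ν + 1) (hy : c ≤ y) :
    ell (shift c y) = ell y := by
  rcases hc with rfl | ⟨ν, rfl⟩
  · rw [shift_zero]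
    rcases eq_or_ne y 0 with rfl | h
    · rw [add_zero, ell_one, ell_zero]
    · exact ell_add 1 h
  · conv_rhs => rw [shift_succ hy, ell_add ν (shift_ne_zero _ _)]

/-! ### Hereditarily periodic sets -/

/-- The characteristic word of `X` on `β` is ultimately periodic: after a prefix of length `b` it
consists of `κ` copies of a word of length `p`. -/
def EventuallyPeriodic (β : Ordinal.{v}) (X : Set Ordinal.{v}) : Prop :=
  ∃ b p κ : Ordinal.{v}, p ≠ 0 ∧ IsSuccLimit κ ∧ β = b + p * κ ∧
    ∀ ξ < κ, ∀ δ < p, (b + (p * ξ + δ) ∈ X ↔ b + δ ∈ X)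

theorem mul_add_lt_mul {p ξ κ δ : Ordinal.{v}} (hξ : ξ < κ) (hδ : δ < p) :
    p * ξ + δ < p * κ :=
  calc p * ξ + δ < p * ξ + p := add_lt_add_right hδ _
    _ = p * succ ξ := (mul_succ _ _).symm
    _ ≤ p * κ := mul_le_mul_right (succ_le_of_lt hξ) _

theorem EventuallyPeriodic.isUltimatelyPeriodic {β : Ordinal.{v}} {X : Set Ordinal.{v}}
    (h : EventuallyPeriodic β X) : (Word.ofSet β X).IsUltimatelyPeriodic := by
  obtain ⟨b, p, κ, hp, hκ, rfl, h⟩ := h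
  let A : Word.{v} := ⟨p, {δ | δ < p ∧ b + δ ∈ X}, fun x hx => hx.1⟩
  refine ⟨Word.ofSet b X, A.iter κ, ⟨A, κ, hp, hκ, rfl⟩, ?_⟩
  ext x
  · rfl
  · constructor
    · rintro ⟨hx, hlt⟩
      rcases lt_or_ge x b with hb | hb
      · exact Or.inl ⟨hx, hb⟩
      · obtain ⟨y, rfl⟩ : ∃ y, x = b + y := ⟨x - b, (Ordinal.add_sub_cancel_of_le hb).symm⟩
        have hy : y < p * κ := lt_of_add_lt_add_left (a := b) hlt
        have hdiv : y / p < κ := (lt_mul_iff_div_lt hp).1 hy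
        rw [← div_add_mod y p] at hx ⊢
        exact Or.inr ⟨_, ⟨y / p, hdiv, y % p,
          ⟨mod_lt y hp, (h _ hdiv _ (mod_lt y hp)).1 hx⟩, rfl⟩, rfl⟩
    · rintro (⟨hx, hb⟩ | ⟨_, ⟨ξ, hξ, δ, ⟨hδ, hX⟩, rfl⟩, rfl⟩)
      · exact ⟨hx, Set.mem_Iio.2 (lt_of_lt_of_le (Set.mem_Iio.1 hb) le_self_add)⟩
      · exact ⟨(h ξ hξ δ hδ).2 hX, add_lt_add_right (mul_add_lt_mul hξ hδ) b⟩

theorem EventuallyPeriodic.congr {β : Ordinal.{v}} {X Y : Set Ordinal.{v}}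
    (h : EventuallyPeriodic β X) (hXY : ∀ y < β, (y ∈ X ↔ y ∈ Y)) : EventuallyPeriodic β Y := by
  obtain ⟨b, p, κ, hp, hκ, rfl, h⟩ := h
  refine ⟨b, p, κ, hp, hκ, rfl, fun ξ hξ δ hδ => ?_⟩
  rw [← hXY _ (add_lt_add_right (mul_add_lt_mul hξ hδ) b), h ξ hξ δ hδ, hXY]
  have h0 : (0 : Ordinal.{v}) < κ := (pos_iff_ne_zero.2 (isSuccLimit_iff.1 hκ).1)
  simpa using add_lt_add_right (mul_add_lt_mul h0 hδ) b

theorem EventuallyPeriodic.prepend {δ : Ordinal.{v}} (a : Ordinal.{v}) {X : Set Ordinal.{v}}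
    (h : EventuallyPeriodic δ {y | a + y ∈ X}) : EventuallyPeriodic (a + δ) X := by
  obtain ⟨b, p, κ, hp, hκ, rfl, h⟩ := h
  refine ⟨a + b, p, κ, hp, hκ, (add_assoc _ _ _).symm, fun ξ hξ δ hδ => ?_⟩
  rw [add_assoc, add_assoc]
  exact h ξ hξ δ hδ

theorem one_add_of_isSuccLimit {β : Ordinal.{v}} (hβ : IsSuccLimit β) : 1 + β = β :=
  one_add_of_omega0_le (omega0_le_of_isSuccLimit hβ)

/-- Removing the first letter. If the prefix is empty then one copy of the period is moved into
the prefix, using `A ^ κ = A A ^ κ`. -/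
theorem EventuallyPeriodic.tail {β : Ordinal.{v}} {X : Set Ordinal.{v}} (hβ : IsSuccLimit β)
    (h : EventuallyPeriodic β X) : EventuallyPeriodic β {y | 1 + y ∈ X} := by
  obtain ⟨b, p, κ, hp, hκ, hb, h⟩ : ∃ b p κ : Ordinal.{v}, p ≠ 0 ∧ IsSuccLimit κ ∧
      1 + β = 1 + b + p * κ ∧ ∀ ξ < κ, ∀ δ < p, (1 + b + (p * ξ + δ) ∈ X ↔ 1 + b + δ ∈ X) := by
    obtain ⟨b, p, κ, hp, hκ, hb, h⟩ := h
    rw [one_add_of_isSuccLimit hβ]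
    rcases eq_or_ne b 0 with rfl | hb0
    · refine ⟨p - 1, p, κ, hp, hκ, ?_, fun ξ hξ δ hδ => ?_⟩
      · rw [Ordinal.add_sub_cancel_of_le (one_le_iff_ne_zero.2 hp), hb, zero_add]
        conv_lhs => rw [← one_add_of_isSuccLimit hκ, mul_add, mul_one]
      · have h1 : (1 : Ordinal.{v}) + ξ < κ := by
          rw [← one_add_of_isSuccLimit hκ]; exact add_lt_add_right hξ 1
        have e1 := h _ h1 δ hδ
        have e2 := h 1 (one_lt_of_isSuccLimit hκ) δ hδ
        rw [Ordinal.add_sub_cancel_of_le (one_le_iff_ne_zero.2 hp), ← add_assoc]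
        simp only [zero_add, mul_add, mul_one] at e1 e2
        rw [e1, e2]
    · refine ⟨b - 1, p, κ, hp, hκ, ?_, ?_⟩ <;>
        rw [Ordinal.add_sub_cancel_of_le (one_le_iff_ne_zero.2 hb0)]
      · exact hb
      · exact h
  rw [add_assoc] at hb
  refine ⟨b, p, κ, hp, hκ, add_left_cancel hb, fun ξ hξ δ hδ => ?_⟩
  have := h ξ hξ δ hδ
  rwa [add_assoc, add_assoc] at this

theorem EventuallyPeriodic.congr_pos {β : Ordinal.{v}} {X Y : Set Ordinal.{v}}
    (hβ : IsSuccLimit β) (h : EventuallyPeriodic β X)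
    (hXY : ∀ y < β, y ≠ 0 → (y ∈ X ↔ y ∈ Y)) : EventuallyPeriodic β Y := by
  rw [← one_add_of_isSuccLimit hβ]
  refine (EventuallyPeriodic.congr (h.tail hβ) fun y hy => hXY _ ?_ ?_).prepend 1
  · rw [← one_add_of_isSuccLimit hβ]; exact add_lt_add_right hy 1
  · exact ne_of_gt (zero_lt_one.trans_le le_self_add)

theorem EventuallyPeriodic.of_mul {p κ : Ordinal.{v}} {X : Set Ordinal.{v}} (hp : p ≠ 0)
    (hκ : IsSuccLimit κ) (h : ∀ ξ < κ, ∀ δ < p, (p * ξ + δ ∈ X ↔ δ ∈ X)) :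
    EventuallyPeriodic (p * κ) X :=
  ⟨0, p, κ, hp, hκ, (zero_add _).symm, by simpa using h⟩

theorem EventuallyPeriodic.of_forall_notMem {β : Ordinal.{v}} {X : Set Ordinal.{v}}
    (hβ : IsSuccLimit β) (h : ∀ y < β, y ∉ X) : EventuallyPeriodic β X := by
  refine EventuallyPeriodic.congr (X := ∅) ?_ fun y hy => by simp [h y hy]
  rw [← one_mul β]
  exact EventuallyPeriodic.of_mul one_ne_zero hβ (by simp)

/-- `X` is eventually periodic at every limit ordinal, without a bound on `X`. -/
def IsPeriodicClass (X : Set Ordinal.{v}) : Prop :=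
  ∀ β, IsSuccLimit β → EventuallyPeriodic β X

theorem IsPeriodicClass.mem_periodicBase {Ω : Ordinal.{v}} {X : Set Ordinal.{v}}
    (h : IsPeriodicClass X) (hX : X ⊆ Set.Iio Ω) : X ∈ periodicBase Ω :=
  ⟨hX, fun β _ hβ => (h β hβ).isUltimatelyPeriodic⟩

theorem isPeriodicClass_univ : IsPeriodicClass (Set.univ : Set Ordinal.{v}) := fun β hβ => by
  rw [← one_mul β]
  exact EventuallyPeriodic.of_mul one_ne_zero hβ (by simp)

theorem IsPeriodicClass.congr_pos {X Y : Set Ordinal.{v}} (h : IsPeriodicClass X)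
    (hXY : ∀ y, y ≠ 0 → (y ∈ X ↔ y ∈ Y)) : IsPeriodicClass Y :=
  fun β hβ => (h β hβ).congr_pos hβ fun y _ => hXY y

theorem IsPeriodicClass.tail {X : Set Ordinal.{v}} (h : IsPeriodicClass X) :
    IsPeriodicClass {y | 1 + y ∈ X} := fun β hβ => (h β hβ).tail hβ

theorem IsPeriodicClass.inter_Iio {X : Set Ordinal.{v}} (h : IsPeriodicClass X)
    (c : Ordinal.{v}) : IsPeriodicClass (X ∩ Set.Iio c) := fun β hβ => by
  rcases le_or_gt β c with hc | hc
  · exact EventuallyPeriodic.congr (h β hβ) fun y hy => by simp [hy.trans_le hc]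
  · rw [← Ordinal.add_sub_cancel_of_le hc.le]
    have hβ' := isSuccLimit_sub (isSuccLimit_iff.1 hβ).2 hc
    refine (EventuallyPeriodic.of_forall_notMem hβ' fun y hy => ?_).prepend c
    rintro ⟨-, h2⟩
    exact absurd (Set.mem_Iio.1 h2) (not_lt.2 le_self_add)

theorem IsPeriodicClass.translate {X : Set Ordinal.{v}} (h : IsPeriodicClass X)
    (a : Ordinal.{v}) : IsPeriodicClass {z | a < z ∧ z - a ∈ X} := fun β hβ => by
  rcases le_or_gt β a with ha | ha
  · exact EventuallyPeriodic.of_forall_notMem hβ fun y hy hy' => absurd (hy.trans_le ha) hy'.1.asymm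
  · rw [← Ordinal.add_sub_cancel_of_le ha.le]
    have hβ' := isSuccLimit_sub (isSuccLimit_iff.1 hβ).2 ha
    refine ((h _ hβ').congr_pos hβ' fun y _ hy0 => ?_).prepend a
    simp [pos_iff_ne_zero.2 hy0]

/-! ### Block repetition -/

/-- The position of `z` inside its block, when the positive ordinals are cut into consecutive
blocks `(κ * ξ, κ * ξ + κ]`. At the remaining points `κ * ξ`, `ξ` a limit, the value is `κ`. -/
noncomputable def blockPos (κ z : Ordinal.{v}) : Ordinal.{v} :=
  open Classical in if z % κ = 0 then κ else z % κ

theorem blockPos_mul_add {κ δ : Ordinal.{v}} (ξ : Ordinal.{v}) (h0 : δ ≠ 0) (h : δ ≤ κ) :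
    blockPos κ (κ * ξ + δ) = δ := by
  rw [blockPos, mul_add_mod_self]
  rcases eq_or_lt_of_le h with rfl | h
  · rw [mod_self, if_pos rfl]
  · rw [mod_eq_of_lt h, if_neg h0]

theorem blockPos_mul_add_eq (κ ξ δ : Ordinal.{v}) :
    blockPos κ (κ * ξ + δ) = blockPos κ δ := by
  rw [blockPos, mul_add_mod_self, blockPos]

theorem mul_add_pos_cases {κ z : Ordinal.{v}} (hκ : κ ≠ 0) (hz : z ≠ 0) :
    (∃ ξ δ, δ ≠ 0 ∧ δ ≤ κ ∧ z = κ * ξ + δ) ∨ ∃ ξ, IsSuccLimit ξ ∧ z = κ * ξ := by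
  by_cases hm : z % κ = 0
  · have hd := div_add_mod z κ
    rw [hm, add_zero] at hd
    rcases zero_or_succ_or_isSuccLimit (z / κ) with h0 | ⟨η, h⟩ | h
    · rw [h0, mul_zero] at hd
      exact absurd hd.symm hz
    · refine Or.inl ⟨η, κ, hκ, le_rfl, ?_⟩
      rw [← mul_succ, h, hd]
    · exact Or.inr ⟨z / κ, h, hd.symm⟩
  · exact Or.inl ⟨z / κ, z % κ, hm, (mod_lt z hκ).le, (div_add_mod z κ).symm⟩

theorem ell_mul_add_le {κ ξ δ : Ordinal.{v}} (h0 : δ ≠ 0) (h : δ ≤ κ) :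
    ell (κ * ξ + δ) ≤ log ω κ := by
  rw [ell_add _ h0]
  exact ell_le_log h0 h

/-- The points inside the blocks are those of rank at most `log κ`. -/
theorem exists_eq_mul_add {κ z : Ordinal.{v}} (hκ : κ ≠ 0) (hz : z ≠ 0)
    (h : ell z < log ω κ + 1) : ∃ ξ δ, δ ≠ 0 ∧ δ ≤ κ ∧ z = κ * ξ + δ := by
  rcases mul_add_pos_cases hκ hz with h1 | ⟨ξ, hξ, rfl⟩
  · exact h1
  · exact absurd h (not_lt.2 (log_lt_ell_mul hκ hξ))

theorem exists_eq_mul_limit {κ z : Ordinal.{v}} (hκ : κ ≠ 0) (hz : z ≠ 0)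
    (h : log ω κ + 1 ≤ ell z) : ∃ ξ, IsSuccLimit ξ ∧ z = κ * ξ := by
  rcases mul_add_pos_cases hκ hz with ⟨ξ, δ, h0, h1, rfl⟩ | h1
  · exact absurd (ell_mul_add_le h0 h1) (not_le.2 ((lt_succ _).trans_le (by
      rwa [succ_eq_add_one])))
  · exact h1

/-- At a limit `κ * ξ + δ` with `0 < δ ≤ κ` the word ends, up to one letter, in an initial segment of
`X`; at `κ * ξ`, `ξ` a limit, it is a power. -/
theorem IsPeriodicClass.blocks {X : Set Ordinal.{v}} (h : IsPeriodicClass X) {κ : Ordinal.{v}}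
    (hκ : κ ≠ 0) : IsPeriodicClass {z | blockPos κ z ∈ X} := fun β hβ => by
  rcases mul_add_pos_cases hκ (isSuccLimit_iff.1 hβ).1 with ⟨ξ, δ, h0, h1, rfl⟩ | ⟨ξ, hξ, rfl⟩
  · have hδ : IsSuccLimit δ := by
      have := isSuccLimit_sub (b := κ * ξ) (isSuccLimit_iff.1 hβ).2
        (lt_add_of_pos_right _ (pos_iff_ne_zero.2 h0))
      rwa [Ordinal.add_sub_cancel] at this
    refine ((h δ hδ).congr_pos hδ fun y hy hy0 => ?_).prepend _
    simp only [Set.mem_ofPred_eq, blockPos_mul_add ξ hy0 (hy.le.trans h1)]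
  · refine EventuallyPeriodic.of_mul hκ hξ fun η _ δ _ => ?_
    simp only [Set.mem_ofPred_eq, blockPos_mul_add_eq]

/-! ### Unbounded `n`-periodic classes -/

/-- The analogue of `periodicGen Ω n` without the bound `Ω`. -/
def periodicClass : ℕ → Set (Set Ordinal.{v})
  | 0 => {X | IsPeriodicClass X}
  | n + 1 => {X | ∃ B, IsPeriodicClass B ∧ ∃ A ∈ periodicClass n, X = B ∩ ell ⁻¹' A}

theorem mem_periodicGen {n : ℕ} {Ω : Ordinal.{v}} {X : Set Ordinal.{v}}
    (h : X ∈ periodicClass n) : X ∩ Set.Iio Ω ∈ periodicGen Ω n := by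
  induction n generalizing X with
  | zero => exact (IsPeriodicClass.inter_Iio h Ω).mem_periodicBase Set.inter_subset_right
  | succ n ih =>
    obtain ⟨B, hB, A, hA, rfl⟩ := h
    refine ⟨B ∩ Set.Iio Ω, (hB.inter_Iio Ω).mem_periodicBase Set.inter_subset_right, _, ih hA, ?_⟩
    ext z
    constructor
    · rintro ⟨⟨h1, h2⟩, h3⟩
      exact ⟨⟨h1, h3⟩, h2, (ell_le_self z).trans_lt h3⟩
    · rintro ⟨⟨h1, h3⟩, h2, -⟩
      exact ⟨⟨h1, h2⟩, h3⟩

theorem periodicClass_inter_Iio {n : ℕ} {X : Set Ordinal.{v}} (h : X ∈ periodicClass n)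
    (c : Ordinal.{v}) : X ∩ Set.Iio c ∈ periodicClass n := by
  rcases n with _ | n
  · exact IsPeriodicClass.inter_Iio h c
  · obtain ⟨B, hB, A, hA, rfl⟩ := h
    exact ⟨_, hB.inter_Iio c, A, hA, Set.inter_right_comm _ _ _⟩

/-- Only the levels above `0` see `ℓ`: the truncation takes place inside `ℓ ⁻¹`. -/
theorem periodicClass_inter_ell_lt {n : ℕ} {X : Set Ordinal.{v}}
    (h : X ∈ periodicClass (n + 1)) (c : Ordinal.{v}) :
    X ∩ {z | ell z < c} ∈ periodicClass (n + 1) := by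
  obtain ⟨B, hB, A, hA, rfl⟩ := h
  exact ⟨B, hB, _, periodicClass_inter_Iio hA c, Set.inter_assoc _ _ _⟩

theorem periodicClass_translate {n : ℕ} {X : Set Ordinal.{v}} (h : X ∈ periodicClass n)
    (a : Ordinal.{v}) : {z | a < z ∧ z - a ∈ X} ∈ periodicClass n := by
  rcases n with _ | n
  · exact IsPeriodicClass.translate h a
  · obtain ⟨B, hB, A, hA, rfl⟩ := h
    refine ⟨_, hB.translate a, A, hA, ?_⟩
    ext z
    simp only [Set.mem_ofPred_eq, Set.mem_inter_iff, Set.mem_preimage, and_assoc]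
    refine and_congr_right fun hz => and_congr_right fun _ => ?_
    rw [← ell_add a (Ordinal.sub_ne_zero_iff_lt.2 hz), Ordinal.add_sub_cancel_of_le hz.le]

theorem periodicClass_shift {n : ℕ} {X : Set Ordinal.{v}} (h : X ∈ periodicClass n)
    {c : Ordinal.{v}} (hc : c = 0 ∨ ∃ ν, c = ν + 1) :
    {y | c ≤ y ∧ shift c y ∈ X} ∈ periodicClass n := by
  have key : ∀ {B : Set Ordinal.{v}}, IsPeriodicClass B →
      IsPeriodicClass {y | c ≤ y ∧ shift c y ∈ B} := by
    intro B hB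
    rcases hc with rfl | ⟨ν, rfl⟩
    · simpa [shift_zero] using hB.tail
    · convert hB.translate ν using 1
      ext y
      simp only [Set.mem_ofPred_eq, ← succ_eq_add_one, succ_le_iff]
      refine and_congr_right fun hy => ?_
      rw [← succ_le_iff, succ_eq_add_one] at hy
      have e : y - ν = shift (ν + 1) y := by
        conv_lhs => rw [shift_succ hy, Ordinal.add_sub_cancel]
      rw [e, succ_eq_add_one]
  rcases n with _ | n
  · exact key h
  · obtain ⟨B, hB, A, hA, rfl⟩ := h
    refine ⟨_, key hB, A, hA, ?_⟩
    ext y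
    simp only [Set.mem_ofPred_eq, Set.mem_inter_iff, Set.mem_preimage, and_assoc]
    refine and_congr_right fun hy => and_congr_right fun _ => ?_
    rw [ell_shift hc hy]

theorem periodicClass_blocks {n : ℕ} {X : Set Ordinal.{v}} (h : X ∈ periodicClass n)
    {κ : Ordinal.{v}} (hκ : κ ≠ 0) : ∃ Y ∈ periodicClass n, ∀ z, z ≠ 0 → ell z < log ω κ + 1 →
      (z ∈ Y ↔ blockPos κ z ∈ X) := by
  rcases n with _ | n
  · exact ⟨_, IsPeriodicClass.blocks h hκ, fun z _ _ => Iff.rfl⟩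
  · obtain ⟨B, hB, A, hA, rfl⟩ := h
    refine ⟨_, ⟨_, hB.blocks hκ, A, hA, rfl⟩, fun z hz hl => and_congr_right fun _ => ?_⟩
    obtain ⟨ξ, δ, h0, h1, rfl⟩ := exists_eq_mul_add hκ hz hl
    rw [Set.mem_preimage, Set.mem_preimage, blockPos_mul_add ξ h0 h1, ell_add _ h0]

/-- Finite unions of members of `periodicClass n`. -/
def IsPeriodicUnion (n : ℕ) (S : Set Ordinal.{v}) : Prop :=
  ∃ F : Set (Set Ordinal.{v}), F.Finite ∧ F ⊆ periodicClass n ∧ S = ⋃₀ F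

theorem IsPeriodicUnion.of_mem {n : ℕ} {S : Set Ordinal.{v}} (h : S ∈ periodicClass n) :
    IsPeriodicUnion n S := ⟨{S}, Set.finite_singleton _, by simpa using h, by simp⟩

theorem IsPeriodicUnion.empty (n : ℕ) : IsPeriodicUnion n (∅ : Set Ordinal.{v}) :=
  ⟨∅, Set.finite_empty, Set.empty_subset _, by simp⟩

theorem IsPeriodicUnion.union {n : ℕ} {S S' : Set Ordinal.{v}} (h : IsPeriodicUnion n S)
    (h' : IsPeriodicUnion n S') : IsPeriodicUnion n (S ∪ S') := by
  obtain ⟨F, hF, hF', rfl⟩ := h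
  obtain ⟨G, hG, hG', rfl⟩ := h'
  exact ⟨F ∪ G, hF.union hG, Set.union_subset hF' hG', Set.sUnion_union F G |>.symm⟩

/-- An operation that is a partial preimage on a domain `Q` extends from `periodicClass` to finite
unions. -/
theorem IsPeriodicUnion.transform {n m : ℕ} {S : Set Ordinal.{v}} (h : IsPeriodicUnion n S)
    (Q P : Ordinal.{v} → Prop) (φ : Ordinal.{v} → Ordinal.{v})
    (H : ∀ X ∈ periodicClass n, ∃ Y ∈ periodicClass m, ∀ z, Q z → (z ∈ Y ↔ P z ∧ φ z ∈ X)) :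
    ∃ S', IsPeriodicUnion m S' ∧ ∀ z, Q z → (z ∈ S' ↔ P z ∧ φ z ∈ S) := by
  obtain ⟨F, hF, hF', rfl⟩ := h
  choose! G hG hG' using H
  refine ⟨_, ⟨G '' F, hF.image G, ?_, rfl⟩, fun z hz => ?_⟩
  · rintro _ ⟨X, hX, rfl⟩
    exact hG X (hF' hX)
  · simp only [Set.mem_sUnion, Set.exists_mem_image]
    constructor
    · rintro ⟨X, hX, hzX⟩
      obtain ⟨h1, h2⟩ := (hG' X (hF' hX) z hz).1 hzX
      exact ⟨h1, X, hX, h2⟩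
    · rintro ⟨h1, X, hX, h2⟩
      exact ⟨X, hX, (hG' X (hF' hX) z hz).2 ⟨h1, h2⟩⟩

/-! ### Pointwise form of `J_n`-morphisms -/

section Local

variable {T : Type u} {n : ℕ} {R : ℕ → T → T → Prop}

/-- The conditions defining a `J_n`-morphism, localized at the point `x`. For `k = n` every node is
a hereditary `(k + 1)`-root and `RStar n R n` is `R n`, so that `self` at `k = n` says that `f` is
continuous at `x` and has discrete fibres. -/
structure IsLocalJ (n : ℕ) (R : ℕ → T → T → Prop) (f : Ordinal.{v} → T) (x : Ordinal.{v}) :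
    Prop where
  freq : ∀ k ≤ n, ∀ y, R k (f x) y → ∃ᶠ z in nb k x, f z = y
  above : ∀ k ≤ n, ∀ w, IsHereditaryRoot n R (k + 1) w → RStar n R k w (f x) →
    ∀ᶠ z in nb k x, RStar n R k w (f z)
  self : ∀ k ≤ n, IsHereditaryRoot n R (k + 1) (f x) →
    ∀ᶠ z in nb k x, z ≠ x → RStar n R k (f x) (f z)

theorem IsLocalJ.congr {f g : Ordinal.{v} → T} {x : Ordinal.{v}} (h : IsLocalJ n R f x)
    (hfg : f =ᶠ[nb 0 x] g) : IsLocalJ n R g x := by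
  have hx : f x = g x := hfg.filter_mono (pure_le_nb 0 x)
  have hk : ∀ k, ∀ᶠ z in nb k x, f z = g z := fun k => hfg.filter_mono (nb_le_zero k x)
  refine ⟨fun k hkn y hy => ?_, fun k hkn w hw hwx => ?_, fun k hkn hw => ?_⟩
  · rw [← hx] at hy
    exact ((h.freq k hkn y hy).and_eventually (hk k)).mono fun z hz => hz.2 ▸ hz.1
  · rw [← hx] at hwx
    filter_upwards [h.above k hkn w hw hwx, hk k] with z h1 h2
    rwa [← h2]
  · rw [← hx] at hw
    filter_upwards [h.self k hkn hw, hk k] with z h1 h2 hzx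
    rw [← hx, ← h2]
    exact h1 hzx

theorem IsLocalJ.translate {f : Ordinal.{v} → T} {γ δ : Ordinal.{v}} (hδ : δ ≠ 0)
    (h : IsLocalJ n R (fun t => f (γ + t)) δ) : IsLocalJ n R f (γ + δ) := by
  refine ⟨fun k hkn y hy => ?_, fun k hkn w hw hwx => ?_, fun k hkn hw => ?_⟩
  · rw [← map_add_nb k γ hδ]
    exact h.freq k hkn y hy
  · rw [← map_add_nb k γ hδ]
    exact h.above k hkn w hw hwx
  · rw [← map_add_nb k γ hδ]
    refine (h.self k hkn hw).mono fun z hz hne => hz fun h0 => hne ?_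
    simp only [h0]

/-! ### Generated subframes -/

/-- `ι` embeds `(W, R)` into `(T, R')` as an upward closed subframe in which no point of `W` is
distinguished from another by its predecessors outside `W`. -/
structure IsSubframe {W : Type u} (n : ℕ) (R : ℕ → W → W → Prop) (R' : ℕ → T → T → Prop)
    (ι : W → T) : Prop where
  inj : Function.Injective ι
  rel : ∀ k a b, R' k (ι a) (ι b) ↔ R k a b
  up : ∀ k a y, R' k (ι a) y → ∃ b, ι b = y
  outer : ∀ k w a b, (∀ c, ι c ≠ w) → R' k w (ι a) → R' k w (ι b)

section Subframe

variable {W : Type u} {R' : ℕ → T → T → Prop} {RW : ℕ → W → W → Prop} {ι : W → T}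

theorem IsSubframe.rStar (hι : IsSubframe n RW R' ι) (k : ℕ) (a b : W) :
    RStar n R' k (ι a) (ι b) ↔ RStar n RW k a b := by
  simp only [RStar, hι.rel]

theorem IsSubframe.hereditaryRoot (hι : IsSubframe n RW R' ι) {k : ℕ} {a : W}
    (h : IsHereditaryRoot n R' k (ι a)) : IsHereditaryRoot n RW k a :=
  fun b hb => h (ι b) ((hι.rStar k b a).2 hb)

theorem IsSubframe.isLocalJ (hι : IsSubframe n RW R' ι) {f : Ordinal.{v} → W} {x : Ordinal.{v}}
    (h : IsLocalJ n RW f x) : IsLocalJ n R' (fun z => ι (f z)) x := by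
  refine ⟨fun k hkn y hy => ?_, fun k hkn w hw hwx => ?_, fun k hkn hw => ?_⟩
  · obtain ⟨b, rfl⟩ := hι.up k _ y hy
    exact (h.freq k hkn b ((hι.rel _ _ _).1 hy)).mono fun z hz => by rw [hz]
  · by_cases hr : ∃ a, ι a = w
    · obtain ⟨a, rfl⟩ := hr
      refine (h.above k hkn a (hι.hereditaryRoot hw) ((hι.rStar _ _ _).1 hwx)).mono fun z hz => ?_
      exact (hι.rStar _ _ _).2 hz
    · obtain ⟨i, h1, h2, h3⟩ := hwx
      exact Eventually.of_forall fun z =>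
        ⟨i, h1, h2, hι.outer i w _ _ (fun a ha => hr ⟨a, ha⟩) h3⟩
  · refine (h.self k hkn (hι.hereditaryRoot hw)).mono fun z hz hne => ?_
    exact (hι.rStar _ _ _).2 (hz hne)

end Subframe

/-! ### Covers -/

/-- `f` restricted to `[1, lam]` is, as a map into the frame `T`, locally a `J_n`-morphism, has
image `S`, and preserves the algebra. -/
structure IsCover (n : ℕ) (R : ℕ → T → T → Prop) (S : Set T) (lam : Ordinal.{v})
    (f : Ordinal.{v} → T) : Prop where
  ne_zero : lam ≠ 0
  lt_tower : lam < tower (n + 2)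
  isLocalJ : ∀ x ≠ 0, x ≤ lam → IsLocalJ n R f x
  mem : ∀ x ≠ 0, x ≤ lam → f x ∈ S
  surj : ∀ u ∈ S, ∃ x ≠ 0, x ≤ lam ∧ f x = u
  algebra : ∀ A : Set T, ∃ X, IsPeriodicUnion n X ∧ ∀ x ≠ 0, x ≤ lam → (x ∈ X ↔ f x ∈ A)

theorem IsSubframe.isCover {W : Type u} {R' : ℕ → T → T → Prop} {RW : ℕ → W → W → Prop}
    {ι : W → T} (hι : IsSubframe n RW R' ι) {S : Set W} {lam : Ordinal.{v}}
    {f : Ordinal.{v} → W} (h : IsCover n RW S lam f) :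
    IsCover n R' (ι '' S) lam (fun z => ι (f z)) where
  ne_zero := h.ne_zero
  lt_tower := h.lt_tower
  isLocalJ x h0 hx := hι.isLocalJ (h.isLocalJ x h0 hx)
  mem x h0 hx := ⟨_, h.mem x h0 hx, rfl⟩
  surj := by
    rintro _ ⟨u, hu, rfl⟩
    obtain ⟨x, h0, hx, rfl⟩ := h.surj u hu
    exact ⟨x, h0, hx, rfl⟩
  algebra A := h.algebra (ι ⁻¹' A)

/-- Concatenation: `[1, lam + lam']` splits into the clopen parts `[1, lam]` and
`(lam, lam + lam']`, the second of which is a translate of `[1, lam']`. -/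
theorem IsCover.union {S S' : Set T} {lam lam' : Ordinal.{v}} {f f' : Ordinal.{v} → T}
    (h : IsCover n R S lam f) (h' : IsCover n R S' lam' f') :
    ∃ lam'' : Ordinal.{v}, ∃ f'', IsCover n R (S ∪ S') lam'' f'' := by
  classical
  let g : Ordinal.{v} → T := fun x => if x ≤ lam then f x else f' (x - lam)
  have hg1 : ∀ x ≤ lam, g x = f x := fun x hx => if_pos hx
  have hg2 : ∀ t ≠ 0, g (lam + t) = f' t := fun t ht => by
    have : ¬ lam + t ≤ lam := not_le.2 (lt_add_of_pos_right lam (pos_iff_ne_zero.2 ht))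
    simp only [g, if_neg this, Ordinal.add_sub_cancel]
  have hcases : ∀ x ≤ lam + lam', x ≤ lam ∨ ∃ t ≠ 0, t ≤ lam' ∧ x = lam + t := by
    intro x hx
    rcases le_or_gt x lam with h1 | h1
    · exact Or.inl h1
    · obtain ⟨t, rfl⟩ : ∃ t, x = lam + t := ⟨x - lam, (Ordinal.add_sub_cancel_of_le h1.le).symm⟩
      exact Or.inr ⟨t, (by rintro rfl; simp at h1), le_of_add_le_add_left hx, rfl⟩
  refine ⟨lam + lam', g, ?_, ?_, ?_, ?_, ?_, ?_⟩
  · exact fun h0 => h.ne_zero (nonpos_iff_eq_zero.1 (h0 ▸ le_self_add))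
  · exact isPrincipal_add_omega0_opow _ h.lt_tower h'.lt_tower
  · intro x h0 hx
    rcases hcases x hx with h1 | ⟨t, ht0, ht, rfl⟩
    · refine (h.isLocalJ x h0 h1).congr ?_
      filter_upwards [Iic_mem_nb 0 x] with z hz
      exact (hg1 z (le_trans hz h1)).symm
    · refine IsLocalJ.translate ht0 ((h'.isLocalJ t ht0 ht).congr ?_)
      filter_upwards [Ioc_mem_nb 0 (pos_iff_ne_zero.2 ht0)] with z hz
      exact (hg2 z hz.1.ne').symm
  · intro x h0 hx
    rcases hcases x hx with h1 | ⟨t, ht0, ht, rfl⟩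
    · rw [hg1 x h1]; exact Or.inl (h.mem x h0 h1)
    · rw [hg2 t ht0]; exact Or.inr (h'.mem t ht0 ht)
  · rintro u (hu | hu)
    · obtain ⟨x, h0, hx, rfl⟩ := h.surj u hu
      exact ⟨x, h0, hx.trans le_self_add, hg1 x hx⟩
    · obtain ⟨t, h0, ht, rfl⟩ := h'.surj u hu
      exact ⟨lam + t, fun h => h0 (nonpos_iff_eq_zero.1 (h ▸ le_add_self)),
        add_le_add_right ht lam, hg2 t h0⟩
  · intro A
    obtain ⟨X, hX, hX'⟩ := h.algebra A
    obtain ⟨Y, hY, hY'⟩ := h'.algebra A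
    obtain ⟨X₁, hX₁, hX₁'⟩ := hX.transform (m := n) (fun _ => True) (· < lam + 1) id
      fun Z hZ => ⟨_, periodicClass_inter_Iio hZ (lam + 1), fun z _ => and_comm⟩
    obtain ⟨Y₁, hY₁, hY₁'⟩ := hY.transform (m := n) (fun _ => True) (lam < ·) (· - lam)
      fun Z hZ => ⟨_, periodicClass_translate hZ lam, fun z _ => Iff.rfl⟩
    refine ⟨X₁ ∪ Y₁, hX₁.union hY₁, fun x h0 hx => ?_⟩
    rw [Set.mem_union, hX₁' x trivial, hY₁' x trivial, ← succ_eq_add_one, lt_succ_iff]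
    rcases hcases x hx with h1 | ⟨t, ht0, ht, rfl⟩
    · simp [h1, hg1 x h1, hX' x h0 h1, not_lt.2 h1]
    · have h2 := lt_add_of_pos_right lam (pos_iff_ne_zero.2 ht0)
      simp [h2, not_le.2 h2, hg2 t ht0, hY' t ht0 ht]

theorem exists_isCover_biUnion {ι : Type*} {s : Finset ι} (hs : s.Nonempty) {S : ι → Set T}
    (h : ∀ i ∈ s, ∃ lam : Ordinal.{v}, ∃ f, IsCover n R (S i) lam f) :
    ∃ lam : Ordinal.{v}, ∃ f, IsCover n R (⋃ i ∈ s, S i) lam f := by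
  induction hs using Finset.Nonempty.cons_induction with
  | singleton a => simpa using h a
  | cons a s ha hs ih =>
    obtain ⟨lam, f, hf⟩ := h a (by simp)
    obtain ⟨lam', f', hf'⟩ := ih fun i hi => h i (by simp [hi])
    simpa using hf.union hf'

/-! ### Filling the points of low rank -/

theorem tower_pos (k : ℕ) : (0 : Ordinal.{v}) < tower k := by
  cases k with
  | zero => exact zero_lt_one
  | succ k => exact opow_pos _ omega0_pos

/-- `g` maps the points of rank below `c` into `S`, satisfying the morphism conditions there, and
takes every value in `S` arbitrarily close to each point of rank at least `c`. -/
structure IsFilling (n : ℕ) (R : ℕ → T → T → Prop) (S : Set T) (c : Ordinal.{v})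
    (g : Ordinal.{v} → T) : Prop where
  eq_zero_or_succ : c = 0 ∨ ∃ ν, c = ν + 1
  lt_tower : c < tower (n + 1)
  isLocalJ : ∀ x ≠ 0, ell x < c → IsLocalJ n R g x
  mem : ∀ x ≠ 0, ell x < c → g x ∈ S
  freq : ∀ x ≠ 0, c ≤ ell x → ∀ u ∈ S, ∃ᶠ z in nb 0 x, ell z < c ∧ g z = u
  algebra : ∀ A : Set T, ∃ X, IsPeriodicUnion n X ∧ ∀ x ≠ 0, ell x < c → (x ∈ X ↔ g x ∈ A)

/-- A cover of `S` by `[1, κ]` is repeated on all blocks `(κ * ξ, κ * ξ + κ]`. -/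
theorem IsCover.isFilling {S : Set T} {κ : Ordinal.{v}} {h : Ordinal.{v} → T}
    (hh : IsCover n R S κ h) :
    IsFilling n R S (log ω κ + 1) (fun x => h (blockPos κ x)) where
  eq_zero_or_succ := Or.inr ⟨_, rfl⟩
  lt_tower := by
    have h1 : log ω κ < tower (n + 1) :=
      (lt_opow_iff_log_lt one_lt_omega0 hh.ne_zero).1 hh.lt_tower
    rw [← succ_eq_add_one]
    exact (isSuccLimit_opow_left isSuccLimit_omega0 (tower_pos n).ne').succ_lt h1
  isLocalJ x h0 hx := by
    obtain ⟨ξ, δ, hδ0, hδ, rfl⟩ := exists_eq_mul_add hh.ne_zero h0 hx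
    refine IsLocalJ.translate hδ0 ((hh.isLocalJ δ hδ0 hδ).congr ?_)
    filter_upwards [Ioc_mem_nb 0 (pos_iff_ne_zero.2 hδ0)] with z hz
    rw [blockPos_mul_add ξ hz.1.ne' (hz.2.trans hδ)]
  mem x h0 hx := by
    obtain ⟨ξ, δ, hδ0, hδ, rfl⟩ := exists_eq_mul_add hh.ne_zero h0 hx
    rw [blockPos_mul_add ξ hδ0 hδ]
    exact hh.mem δ hδ0 hδ
  freq x h0 hx u hu := by
    obtain ⟨ξ, hξ, rfl⟩ := exists_eq_mul_limit hh.ne_zero h0 hx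
    obtain ⟨δ, hδ0, hδ, rfl⟩ := hh.surj u hu
    refine (hasBasis_nb_zero h0).frequently_iff.2 fun {γ} hγ => ?_
    obtain ⟨η, hη, hγη⟩ := (lt_mul_iff_of_isSuccLimit hξ).1 hγ
    refine ⟨κ * η + δ, ⟨hγη.trans_le le_self_add, ?_⟩, ?_, ?_⟩
    · calc κ * η + δ ≤ κ * η + κ := add_le_add_right hδ _
        _ = κ * succ η := (mul_succ _ _).symm
        _ ≤ κ * ξ := mul_le_mul_right (succ_le_of_lt hη) _
    · rw [← succ_eq_add_one, lt_succ_iff]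
      exact ell_mul_add_le hδ0 hδ
    · simp only [blockPos_mul_add η hδ0 hδ]
  algebra A := by
    obtain ⟨X, hX, hX'⟩ := hh.algebra A
    obtain ⟨Y, hY, hY'⟩ := hX.transform (m := n) (fun z => z ≠ 0 ∧ ell z < log ω κ + 1)
      (fun _ => True) (blockPos κ) fun Z hZ => by
        obtain ⟨Y, hY, h⟩ := periodicClass_blocks hZ hh.ne_zero
        exact ⟨Y, hY, fun z hz => by rw [h z hz.1 hz.2]; simp⟩
    refine ⟨Y, hY, fun x h0 hx => ?_⟩
    rw [hY' x ⟨h0, hx⟩]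
    obtain ⟨ξ, δ, hδ0, hδ, rfl⟩ := exists_eq_mul_add hh.ne_zero h0 hx
    rw [blockPos_mul_add ξ hδ0 hδ, hX' δ hδ0 hδ]
    simp

theorem isFilling_empty (n : ℕ) (R : ℕ → T → T → Prop) (g : Ordinal.{v} → T) :
    IsFilling n R ∅ 0 g where
  eq_zero_or_succ := Or.inl rfl
  lt_tower := tower_pos _
  isLocalJ _ _ hx := absurd hx (not_lt.2 zero_le)
  mem _ _ hx := absurd hx (not_lt.2 zero_le)
  freq _ _ _ u hu := absurd hu (Set.notMem_empty u)
  algebra _ := ⟨∅, IsPeriodicUnion.empty n, fun _ _ hx => absurd hx (not_lt.2 zero_le)⟩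

theorem exists_isFilling_biUnion {ι : Type*} (s : Finset ι) {S : ι → Set T} (t : T)
    (h : ∀ i ∈ s, ∃ lam : Ordinal.{v}, ∃ f, IsCover n R (S i) lam f) :
    ∃ c : Ordinal.{v}, ∃ g, IsFilling n R (⋃ i ∈ s, S i) c g := by
  rcases s.eq_empty_or_nonempty with rfl | hs
  · exact ⟨0, fun _ => t, by simpa using isFilling_empty n R (fun _ => t)⟩
  · obtain ⟨lam, f, hf⟩ := exists_isCover_biUnion hs h
    exact ⟨_, _, hf.isFilling⟩

theorem IsFilling.isLocalJ_of_eqOn {S : Set T} {c x : Ordinal.{v}} {f g : Ordinal.{v} → T}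
    (hg : IsFilling n R S c g) (hfg : ∀ z, ell z < c → f z = g z) (h0 : x ≠ 0)
    (hx : ell x < c) : IsLocalJ n R f x := by
  refine (hg.isLocalJ x h0 hx).congr ?_
  rw [nb_zero]
  filter_upwards [(isOpen_ell_lt c).mem_nhds hx] with z hz
  exact (hfg z hz).symm

end Local

/-! ### Covers of trees -/

/-- A cover of `S` in which `lam` is the only point of `[1, lam]` over `r`. -/
structure IsPointedCover {T : Type u} (n : ℕ) (R : ℕ → T → T → Prop) (S : Set T) (r : T)
    (lam : Ordinal.{v}) (f : Ordinal.{v} → T) : Prop extends IsCover n R S lam f where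
  apply_lam : f lam = r
  apply_ne : ∀ x ≠ 0, x < lam → f x ≠ r

theorem isPeriodicClass_Ici (a : Ordinal.{v}) : IsPeriodicClass (Set.Ici a) := fun β hβ => by
  rcases le_or_gt β a with ha | ha
  · exact EventuallyPeriodic.of_forall_notMem hβ fun y hy hy' =>
      absurd (hy.trans_le ha) (not_lt.2 (Set.mem_Ici.1 hy'))
  · rw [← Ordinal.add_sub_cancel_of_le ha.le]
    have hβ' := isSuccLimit_sub (isSuccLimit_iff.1 hβ).2 ha
    exact ((isPeriodicClass_univ _ hβ').congr fun y _ => by simp).prepend a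

theorem rStar_zero_iff {T : Type u} {R : ℕ → T → T → Prop} {x y : T} :
    RStar 0 R 0 x y ↔ R 0 x y := by
  constructor
  · rintro ⟨i, -, hi, h⟩
    obtain rfl := Nat.le_zero.1 hi
    exact h
  · exact fun h => ⟨0, le_rfl, le_rfl, h⟩

/-- Adding a node `w` below a filling of its set of successors, for a single relation. -/
theorem IsFilling.exists_isPointedCover {T : Type u} {R : ℕ → T → T → Prop}
    (htrans : ∀ x y z, R 0 x y → R 0 y z → R 0 x z) (hirr : ∀ x, ¬ R 0 x x) (w : T)
    {c : Ordinal.{v}} {g : Ordinal.{v} → T} (hg : IsFilling 0 R {y | R 0 w y} c g) :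
    ∃ f, IsPointedCover 0 R ({w} ∪ {y | R 0 w y}) w (ω ^ c) f := by
  classical
  let f : Ordinal.{v} → T := fun x => if c ≤ ell x then w else g x
  have hf1 : ∀ x, ell x < c → f x = g x := fun x hx => if_neg (not_le.2 hx)
  have hf2 : f (ω ^ c) = w := if_pos (ell_opow c).ge
  have hlt : ∀ x ≠ 0, x < ω ^ c → ell x < c := fun x => ell_lt_of_lt_opow
  have hne : (ω : Ordinal.{v}) ^ c ≠ 0 := (opow_pos c omega0_pos).ne'
  have hsucc : ∀ x ≠ 0, x < ω ^ c → R 0 w (f x) := fun x h0 hx => by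
    rw [hf1 x (hlt x h0 hx)]
    exact hg.mem x h0 (hlt x h0 hx)
  have hev : ∀ᶠ z in nb 0 (ω ^ c), z ≠ ω ^ c → R 0 w (f z) := by
    filter_upwards [Ioc_mem_nb 0 (pos_iff_ne_zero.2 hne)] with z hz hzc
    exact hsucc z hz.1.ne' (lt_of_le_of_ne hz.2 hzc)
  refine ⟨f, ⟨hne, ?_, ?_, ?_, ?_, ?_⟩, hf2, ?_⟩
  · exact (opow_lt_opow_iff_right one_lt_omega0).2 hg.lt_tower
  · intro x h0 hx
    rcases eq_or_lt_of_le hx with rfl | hx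
    · refine ⟨fun k hk y hy => ?_, fun k hk u hu hux => ?_, fun k hk hw => ?_⟩ <;>
        obtain rfl := Nat.le_zero.1 hk
      · rw [hf2] at hy
        refine (hg.freq _ hne (ell_opow c).ge y hy).mono fun z hz => ?_
        rw [hf1 z hz.1, hz.2]
      · rw [hf2, rStar_zero_iff] at hux
        filter_upwards [hev] with z hz
        rw [rStar_zero_iff]
        rcases eq_or_ne z (ω ^ c) with rfl | hzc
        · rwa [hf2]
        · exact htrans _ _ _ hux (hz hzc)
      · filter_upwards [hev] with z hz hzc
        rw [rStar_zero_iff, hf2]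
        exact hz hzc
    · exact hg.isLocalJ_of_eqOn hf1 h0 (hlt x h0 hx)
  · intro x h0 hx
    rcases eq_or_lt_of_le hx with rfl | hx
    · exact Or.inl hf2
    · exact Or.inr (hsucc x h0 hx)
  · rintro u (rfl | hu)
    · exact ⟨_, hne, le_rfl, hf2⟩
    · obtain ⟨z, ⟨h1, h2⟩, h3⟩ := ((hg.freq _ hne (ell_opow c).ge u hu).and_eventually
        (Ioc_mem_nb 0 (pos_iff_ne_zero.2 hne))).exists
      exact ⟨z, h3.1.ne', h3.2, by rw [hf1 z h1, h2]⟩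
  · intro A
    obtain ⟨X, hX, hX'⟩ := hg.algebra A
    obtain ⟨Y, hY, hY'⟩ := hX.transform (m := 0) (fun _ => True) (· < ω ^ c) id
      fun Z hZ => ⟨_, periodicClass_inter_Iio hZ (ω ^ c), fun z _ => and_comm⟩
    by_cases hw : w ∈ A
    · refine ⟨Y ∪ Set.Ici (ω ^ c), hY.union (.of_mem (isPeriodicClass_Ici _)), fun x h0 hx => ?_⟩
      rw [Set.mem_union, hY' x trivial]
      rcases eq_or_lt_of_le hx with rfl | hx
      · simp [hf2, hw]
      · simp [hx, not_le.2 hx, hX' x h0 (hlt x h0 hx), hf1 x (hlt x h0 hx)]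
    · refine ⟨Y, hY, fun x h0 hx => ?_⟩
      rw [hY' x trivial]
      rcases eq_or_lt_of_le hx with rfl | hx
      · simp [hf2, hw]
      · simp [hx, hX' x h0 (hlt x h0 hx), hf1 x (hlt x h0 hx)]
  · intro x h0 hx h
    exact hirr w (by simpa only [h] using hsucc x h0 hx)

/-- By induction from the leaves: the set of all proper successors of `w` is the union of the cones
of its members. -/
theorem exists_isPointedCover_of_isTransTree {T : Type u} [Finite T] {R : ℕ → T → T → Prop}
    (h : IsTransTree (R 0)) (w : T) : ∃ lam : Ordinal.{v}, ∃ f,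
      IsPointedCover 0 R ({w} ∪ {y | R 0 w y}) w lam f := by
  classical
  obtain ⟨hirr, htrans, -, -⟩ := h
  have : Fintype T := Fintype.ofFinite T
  have : Std.Irrefl (Function.swap (R 0)) := ⟨hirr⟩
  have : IsTrans T (Function.swap (R 0)) := ⟨fun x y z h1 h2 => htrans _ _ _ h2 h1⟩
  induction w using (Finite.wellFounded_of_trans_of_irrefl (Function.swap (R 0))).induction with
  | _ w ih =>
    obtain ⟨c, g, hg⟩ := exists_isFilling_biUnion (n := 0) (R := R)
      (Finset.univ.filter (R 0 w ·)) (S := fun y => {y} ∪ {z | R 0 y z}) w fun y hy => by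
        obtain ⟨lam, f, hf⟩ := ih y (by simpa using hy)
        exact ⟨lam, f, hf.toIsCover⟩
    have hS : (⋃ y ∈ Finset.univ.filter (R 0 w ·), ({y} ∪ {z | R 0 y z})) = {y | R 0 w y} := by
      ext z
      simp only [Finset.mem_filter, Finset.mem_univ, true_and, Set.mem_iUnion, Set.mem_union,
        Set.mem_singleton_iff, Set.mem_ofPred_eq, exists_prop]
      constructor
      · rintro ⟨y, hy, rfl | hz⟩
        · exact hy
        · exact htrans _ _ _ hy hz
      · exact fun hz => ⟨z, hz, Or.inl rfl⟩
    rw [hS] at hg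
    obtain ⟨f, hf⟩ := hg.exists_isPointedCover htrans hirr w
    exact ⟨_, f, hf⟩

/-- The induction hypothesis on `J_n`-trees: there is a root `r` for `RStar n R 0`, all relations
are irreflexive, and the frame has a cover with exactly one point over `r`, its last one. -/
def IsCoverable (n : ℕ) {T : Type u} (R : ℕ → T → T → Prop) : Prop :=
  ∃ r, (∀ x, x ≠ r → RStar n R 0 r x) ∧ (∀ k ≤ n, ∀ x, ¬ R k x x) ∧
    ∃ lam : Ordinal.{v}, ∃ f, IsPointedCover n R Set.univ r lam f

theorem isCoverable_of_isTransTree {T : Type u} [Finite T] {R : ℕ → T → T → Prop}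
    (h : IsTransTree (R 0)) : IsCoverable.{u, v} 0 R := by
  obtain ⟨r, hr⟩ := h.2.2.1
  obtain ⟨lam, f, hf⟩ := exists_isPointedCover_of_isTransTree h r
  refine ⟨r, fun x hx => rStar_zero_iff.2 (hr x hx), fun k hk x => ?_, lam, f, ?_⟩
  · obtain rfl := Nat.le_zero.1 hk
    exact h.1 x
  · have : ({r} ∪ {y | R 0 r y} : Set T) = Set.univ := by
      ext x
      by_cases hx : x = r
      · simp [hx]
      · simp [hr x hx]
    rwa [this] at hf

theorem IsCoverable.of_equiv {n : ℕ} {W W' : Type u} {R : ℕ → W → W → Prop}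
    {R' : ℕ → W' → W' → Prop} (e : W ≃ W') (he : ∀ i x y, R i x y ↔ R' i (e x) (e y))
    (h : IsCoverable.{u, v} n R) : IsCoverable.{u, v} n R' := by
  obtain ⟨r, hr, hirr, lam, f, hf⟩ := h
  have hι : IsSubframe n R R' e :=
    ⟨e.injective, fun k a b => (he k a b).symm, fun _ _ y _ => e.surjective y,
      fun _ w _ _ h => absurd (e.apply_symm_apply w) (h _)⟩
  refine ⟨e r, fun x hx => ?_, fun k hk x hx => ?_, lam, fun z => e (f z), ?_, ?_, ?_⟩
  · obtain ⟨y, rfl⟩ := e.surjective x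
    exact (hι.rStar 0 r y).2 (hr y fun h => hx (h ▸ rfl))
  · obtain ⟨y, rfl⟩ := e.surjective x
    exact hirr k hk y ((he k y y).2 hx)
  · simpa using hι.isCover hf.toIsCover
  · exact congrArg e hf.apply_lam
  · exact fun x h0 hx h => hf.apply_ne x h0 hx (e.injective h)

/-! ### Grafting -/

section Graft

variable {n k : ℕ} {V : Type u} {W : Fin k → Type u} {RV : ℕ → V → V → Prop}
  {RW : ∀ i, ℕ → W i → W i → Prop}

theorem graftRel_inr_iff {i : Fin k} {j : ℕ} {x y : W i} :
    graftRel RV RW j (Sum.inr ⟨i, x⟩) (Sum.inr ⟨i, y⟩) ↔ RW i j x y := by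
  constructor
  · rintro ⟨i', x', y', h1, h2, h3⟩
    cases h1
    cases h2
    exact h3
  · exact fun h => ⟨i, x, y, rfl, rfl, h⟩

theorem graftRel_inl_inr_iff {j : ℕ} {x : V} {p : Σ i, W i} :
    graftRel RV RW j (Sum.inl x) (Sum.inr p) ↔ j = 0 := Iff.rfl

theorem isSubframe_graft (i : Fin k) :
    IsSubframe (n + 1) (RW i) (graftRel RV RW) (fun x => Sum.inr ⟨i, x⟩) where
  inj x y h := by simpa using h
  rel _ _ _ := graftRel_inr_iff
  up := by
    rintro j x (v | p) h
    · exact h.elim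
    · obtain ⟨i', x', y', h1, rfl, h3⟩ := h
      cases h1
      exact ⟨y', rfl⟩
  outer := by
    rintro j (v | p) x y hw h
    · exact h
    · obtain ⟨i', x', y', rfl, h2, h3⟩ := h
      cases h2
      exact absurd rfl (hw x')

theorem rStar_graft_inl {j : ℕ} {x y : V} :
    RStar (n + 1) (graftRel RV RW) (j + 1) (Sum.inl x) (Sum.inl y) ↔ RStar n RV j x y := by
  constructor
  · rintro ⟨_ | i, h1, h2, h⟩
    · omega
    · exact ⟨i, by omega, by omega, h⟩
  · rintro ⟨i, h1, h2, h⟩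
    exact ⟨i + 1, by omega, by omega, h⟩

theorem not_rStar_graft_inr_inl {j : ℕ} {x : V} {p : Σ i, W i} :
    ¬ RStar (n + 1) (graftRel RV RW) j (Sum.inr p) (Sum.inl x) := fun ⟨_, _, _, h⟩ => h

theorem rStar_graft_root {r : V} (hr : ∀ x, x ≠ r → RStar n RV 0 r x) (x : V ⊕ Σ i, W i)
    (hx : x ≠ Sum.inl r) : RStar (n + 1) (graftRel RV RW) 0 (Sum.inl r) x := by
  rcases x with x | p
  · obtain ⟨i, -, h2, h⟩ := rStar_graft_inl.2 (hr x fun h => hx (h ▸ rfl))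
    exact ⟨i, Nat.zero_le _, h2, h⟩
  · exact ⟨0, le_rfl, Nat.zero_le _, rfl⟩

theorem hereditaryRoot_of_graft {j : ℕ} {x : V}
    (h : IsHereditaryRoot (n + 1) (graftRel RV RW) (j + 1) (Sum.inl x)) :
    IsHereditaryRoot n RV j x := fun _ hy => h _ (rStar_graft_inl.2 hy)

/-- The rank function, shifted so as to start at `1` on the points of rank at least `c`, is
continuous and open from `ϑ_{j+1}` to `ϑ_j`. -/
theorem map_shift_ell_nb (j : ℕ) {c x : Ordinal.{v}} (hc : c = 0 ∨ ∃ ν, c = ν + 1) (h0 : x ≠ 0)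
    (hx : c ≤ ell x) :
    map (fun z => shift c (ell z)) (nb (j + 1) x) = nb j (shift c (ell x)) := by
  rw [← map_shift_nb j hc hx, ← map_ell_nb j h0, map_map]
  rfl

theorem eventually_le_ell (j : ℕ) {c x : Ordinal.{v}} (hc : c = 0 ∨ ∃ ν, c = ν + 1) (h0 : x ≠ 0)
    (hx : c ≤ ell x) : ∀ᶠ z in nb (j + 1) x, c ≤ ell z := by
  rcases hc with rfl | ⟨ν, rfl⟩
  · exact Eventually.of_forall fun z => zero_le
  · rw [← succ_eq_add_one, succ_le_iff] at hx
    have : Set.Ioc ν (ell x) ∈ map ell (nb (j + 1) x) := by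
      rw [map_ell_nb j h0]
      exact Ioc_mem_nb j hx
    filter_upwards [mem_map.1 this] with z hz
    rw [← succ_eq_add_one]
    exact succ_le_of_lt hz.1

/-- Grafting: the points of rank at least `c` are mapped to `V` by composing the cover of `V` with
the shifted rank function, the points of rank below `c` are mapped to the grafted frames by a
filling. -/
theorem IsPointedCover.graft {r : V} (hr : ∀ x, x ≠ r → RStar n RV 0 r x) {μ : Ordinal.{v}}
    {fV : Ordinal.{v} → V} (hV : IsPointedCover n RV Set.univ r μ fV) {c : Ordinal.{v}}
    {g : Ordinal.{v} → V ⊕ Σ i, W i}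
    (hg : IsFilling (n + 1) (graftRel RV RW) (Set.range Sum.inr) c g) :
    ∃ lam : Ordinal.{v}, ∃ f,
      IsPointedCover (n + 1) (graftRel RV RW) Set.univ (Sum.inl r) lam f := by
  classical
  obtain ⟨μ', hμ⟩ : ∃ μ', μ = 1 + μ' :=
    ⟨μ - 1, (Ordinal.add_sub_cancel_of_le (one_le_iff_ne_zero.2 hV.ne_zero)).symm⟩
  let f : Ordinal.{v} → V ⊕ Σ i, W i := fun x =>
    if c ≤ ell x then Sum.inl (fV (shift c (ell x))) else g x
  have hf1 : ∀ x, ell x < c → f x = g x := fun x hx => if_neg (not_le.2 hx)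
  have hf2 : ∀ x, c ≤ ell x → f x = Sum.inl (fV (shift c (ell x))) := fun x hx => if_pos hx
  have hc := hg.eq_zero_or_succ
  set lam : Ordinal.{v} := ω ^ (c + μ') with hlam
  have hne : lam ≠ 0 := (opow_pos _ omega0_pos).ne'
  have hflam : f lam = Sum.inl r := by
    rw [hf2 lam (by rw [hlam, ell_opow]; exact le_self_add), hlam, ell_opow, shift_add, ← hμ,
      hV.apply_lam]
  have hle : ∀ x ≠ 0, x ≤ lam → shift c (ell x) ≤ μ := fun x h0 hx => by
    rw [hμ, shift]
    exact add_le_add_right (sub_le.2 (ell_le_of_le_opow h0 hx)) 1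
  have hroot : ∀ x ≠ 0, x < lam → f x ≠ Sum.inl r := fun x h0 hx => by
    rcases lt_or_ge (ell x) c with h | h
    · rw [hf1 x h]
      obtain ⟨p, hp⟩ := hg.mem x h0 h
      rw [← hp]
      exact Sum.inr_ne_inl
    · rw [hf2 x h]
      intro heq
      have hlt : shift c (ell x) < μ := by
        rw [hμ, shift]
        refine add_lt_add_right ((sub_lt_of_le h).2 ?_) 1
        exact ell_lt_of_lt_opow h0 hx
      exact hV.apply_ne _ (shift_ne_zero _ _) hlt (Sum.inl.inj heq)
  have hrootev : ∀ j x, x ≠ 0 → x ≤ lam → ∀ᶠ z in nb j x, z ≠ lam →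
      RStar (n + 1) (graftRel RV RW) 0 (Sum.inl r) (f z) := fun j x h0 hx => by
    filter_upwards [Ioc_mem_nb j (pos_iff_ne_zero.2 h0)] with z hz hzl
    exact rStar_graft_root hr _ (hroot z hz.1.ne' (lt_of_le_of_ne (hz.2.trans hx) hzl))
  refine ⟨lam, f, ⟨hne, ?_, ?_, fun x _ _ => Set.mem_univ _, ?_, ?_⟩, hflam, hroot⟩
  · refine (opow_lt_opow_iff_right one_lt_omega0).2 (isPrincipal_add_omega0_opow _ hg.lt_tower ?_)
    exact lt_of_le_of_lt (hμ ▸ le_add_self) hV.lt_tower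
  · intro x h0 hx
    rcases lt_or_ge (ell x) c with h | h
    · exact hg.isLocalJ_of_eqOn hf1 h0 h
    have hJ := hV.isLocalJ _ (shift_ne_zero c (ell x)) (hle x h0 hx)
    have hmap := fun j => map_shift_ell_nb j hc h0 h
    have hev := fun j => eventually_le_ell j hc h0 h
    refine ⟨fun j hj y hy => ?_, fun j hj w hw hwx => ?_, fun j hj hw => ?_⟩
    · rw [hf2 x h] at hy
      rcases y with y | p
      · rcases j with _ | j
        · exact hy.elim
        · have hfr := hJ.freq j (by omega) y hy
          rw [← hmap j] at hfr
          refine (Frequently.and_eventually (frequently_map.1 hfr) (hev j)).mono fun z hz => ?_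
          rw [hf2 z hz.2, hz.1]
      · obtain rfl := graftRel_inl_inr_iff.1 hy
        refine (hg.freq x h0 h _ ⟨p, rfl⟩).mono fun z hz => ?_
        rw [hf1 z hz.1, hz.2]
    · rcases w with w | p
      · have hw' := hereditaryRoot_of_graft hw
        rcases j with _ | j
        · -- a hereditary `0`-root of `V` is the root of `V`
          obtain rfl : w = r := by
            by_contra hne
            exact hw' r (hr w hne)
          filter_upwards [hrootev 0 x h0 hx, Iic_mem_nb 0 x] with z hz hzx
          by_cases hzl : z = lam
          · rwa [hzl, ← le_antisymm hx (hzl ▸ hzx)]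
          · exact hz hzl
        · rw [hf2 x h, rStar_graft_inl] at hwx
          have h1 := hJ.above j (by omega) w hw' hwx
          rw [← hmap j, eventually_map] at h1
          filter_upwards [h1, hev j] with z hz1 hz2
          rw [hf2 z hz2, rStar_graft_inl]
          exact hz1
      · rw [hf2 x h] at hwx
        exact absurd hwx not_rStar_graft_inr_inl
    · rw [hf2 x h] at hw
      have hw' := hereditaryRoot_of_graft hw
      rcases j with _ | j
      · have hxr : f x = Sum.inl r := by
          rw [hf2 x h]
          by_contra hne
          exact hw' r (hr _ fun h => hne (h ▸ rfl))
        obtain rfl : x = lam := by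
          by_contra hne
          exact hroot x h0 (lt_of_le_of_ne hx hne) hxr
        rw [hxr]
        exact hrootev 0 lam h0 hx
      · have h1 := hJ.self j (by omega) hw'
        rw [← hmap j, eventually_map] at h1
        filter_upwards [h1, hev j, eventually_ell_lt (j + 1) h0] with z hz1 hz2 hz3 hzx
        rw [hf2 z hz2, hf2 x h, rStar_graft_inl]
        exact hz1 fun heq => (hz3 hzx).ne (shift_inj hz2 h heq)
  · rintro (y | p) -
    · obtain ⟨t, ht0, ht, rfl⟩ := hV.surj y (Set.mem_univ _)
      obtain ⟨s, rfl⟩ : ∃ s, t = 1 + s :=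
        ⟨t - 1, (Ordinal.add_sub_cancel_of_le (one_le_iff_ne_zero.2 ht0)).symm⟩
      refine ⟨ω ^ (c + s), (opow_pos _ omega0_pos).ne', ?_, ?_⟩
      · rw [hμ] at ht
        exact opow_le_opow_right omega0_pos (add_le_add_right (le_of_add_le_add_left ht) c)
      · rw [hf2 _ (by rw [ell_opow]; exact le_self_add), ell_opow, shift_add]
    · obtain ⟨z, ⟨h1, h2⟩, h3⟩ := ((hg.freq lam hne
        (by rw [hlam, ell_opow]; exact le_self_add) _ ⟨p, rfl⟩).and_eventually
        (Ioc_mem_nb 0 (pos_iff_ne_zero.2 hne))).exists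
      exact ⟨z, h3.1.ne', h3.2, by rw [hf1 z h1, h2]⟩
  · intro A
    obtain ⟨X, hX, hX'⟩ := hV.algebra (Sum.inl ⁻¹' A)
    obtain ⟨Y, hY, hY'⟩ := hg.algebra A
    obtain ⟨X₁, hX₁, hX₁'⟩ := hX.transform (m := n + 1) (fun _ => True) (fun z => c ≤ ell z)
      (fun z => shift c (ell z)) fun Z hZ =>
        ⟨_, ⟨_, isPeriodicClass_univ, _, periodicClass_shift hZ hc, rfl⟩, fun z _ => by simp⟩
    obtain ⟨Y₁, hY₁, hY₁'⟩ := hY.transform (m := n + 1) (fun _ => True) (fun z => ell z < c) id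
      fun Z hZ => ⟨_, periodicClass_inter_ell_lt hZ c, fun z _ => and_comm⟩
    refine ⟨X₁ ∪ Y₁, hX₁.union hY₁, fun x h0 hx => ?_⟩
    rw [Set.mem_union, hX₁' x trivial, hY₁' x trivial]
    rcases lt_or_ge (ell x) c with h | h
    · simp [h, not_le.2 h, hf1 x h, hY' x h0 h]
    · simp [h, not_lt.2 h, hf2 x h, hX' _ (shift_ne_zero _ _) (hle x h0 hx)]

theorem IsCoverable.graft (hV : IsCoverable.{u, v} n RV)
    (hW : ∀ i, IsCoverable.{u, v} (n + 1) (RW i)) :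
    IsCoverable.{u, v} (n + 1) (graftRel RV RW) := by
  obtain ⟨r, hr, hirr, μ, fV, hfV⟩ := hV
  obtain ⟨c, g, hg⟩ := exists_isFilling_biUnion (n := n + 1) (R := graftRel RV RW)
    (Finset.univ : Finset (Fin k)) (S := fun i => Set.range fun x : W i => Sum.inr ⟨i, x⟩)
    (Sum.inl r) fun i _ => by
      obtain ⟨_, _, _, lam, f, hf⟩ := hW i
      exact ⟨lam, _, by simpa using (isSubframe_graft i).isCover hf.toIsCover⟩
  have hS : (⋃ i ∈ (Finset.univ : Finset (Fin k)),
      Set.range fun x : W i => (Sum.inr ⟨i, x⟩ : V ⊕ Σ i, W i)) = Set.range Sum.inr := by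
    ext z
    simp [Sigma.exists]
  rw [hS] at hg
  refine ⟨Sum.inl r, rStar_graft_root hr, ?_, hfV.graft hr hg⟩
  rintro j hj (x | ⟨i, x⟩) h
  · rcases j with _ | j
    · exact h
    · exact hirr j (by omega) x h
  · exact (hW i).elim fun _ h' => h'.2.1 j hj x (graftRel_inr_iff.1 h)

end Graft

theorem IsJTree.isCoverable {n : ℕ} {T : Type u} {R : ℕ → T → T → Prop} (h : IsJTree n T R) :
    IsCoverable.{u, v} n R := by
  induction h with
  | base W R hfin htree hempty => exact isCoverable_of_isTransTree htree
  | plus n W R h ih =>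
    -- `W⁺` is the graft of no frames onto `W`
    refine (ih.graft (k := 0) (W := fun _ => PEmpty) (RW := fun _ _ _ _ => False)
      (fun i => i.elim0)).of_equiv (Equiv.sumEmpty W _) ?_
    rintro i (x | ⟨⟨_, h⟩, _⟩) (y | ⟨⟨_, h⟩, _⟩)
    · rfl
    all_goals omega
  | graft n V RV k W RW hV hW ihV ihW => exact ihV.graft ihW
  | iso n W W' R R' e he h ih => exact ih.of_equiv e he

/-! ### From local to global -/

section Global

variable {T : Type u} {n : ℕ} {R : ℕ → T → T → Prop} {lam : Ordinal.{v}}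

theorem ne_zero_of_mem_Icc (x : Set.Icc 1 lam) : (x : Ordinal.{v}) ≠ 0 :=
  one_le_iff_ne_zero.1 x.2.1

theorem nhds_icardIcc (k : ℕ) (x : Set.Icc 1 lam) :
    @nhds _ (icardIcc lam k) x = comap Subtype.val (nb k x) :=
  @nhds_induced _ _ (icard k) Subtype.val x

theorem map_nhds_icardIcc (k : ℕ) (x : Set.Icc 1 lam) :
    map Subtype.val (@nhds _ (icardIcc lam k) x) = nb k x := by
  rw [nhds_icardIcc, map_comap, inf_eq_left, le_principal_iff, Subtype.range_coe_subtype]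
  filter_upwards [Ioc_mem_nb k (pos_iff_ne_zero.2 (ne_zero_of_mem_Icc x))] with z hz
  exact ⟨one_le_iff_ne_zero.2 hz.1.ne', hz.2.trans x.2.2⟩

theorem isOpen_icardIcc_iff {k : ℕ} {s : Set (Set.Icc 1 lam)} :
    IsOpen[icardIcc lam k] s ↔ ∀ x ∈ s, s ∈ @nhds _ (icardIcc lam k) x :=
  @isOpen_iff_mem_nhds _ (icardIcc lam k) s

theorem isDiscrete_icardIcc {k : ℕ} {s : Set (Set.Icc 1 lam)}
    (h : ∀ x ∈ s, ∀ᶠ z : Set.Icc 1 lam in @nhds _ (icardIcc lam k) x, z ≠ x → z ∉ s) :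
    @IsDiscrete _ (icardIcc lam k) s := by
  let := icardIcc lam k
  refine IsDiscrete.of_nhdsWithin fun x hx => le_pure_iff.2 ?_
  rw [mem_nhdsWithin_iff_eventually]
  refine (h x hx).mono fun z hz hzs => ?_
  by_contra hzx
  exact hz hzx hzs

/-- Irreflexivity converts the punctured-neighbourhood conditions into discreteness. -/
theorem IsCover.isJMorphism {f : Ordinal.{v} → T} (hirr : ∀ k ≤ n, ∀ x, ¬ R k x x)
    (h : IsCover n R Set.univ lam f) :
    IsJMorphism n (icardIcc lam) R (fun x : Set.Icc 1 lam => f x) := by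
  have hJ : ∀ x : Set.Icc 1 lam, IsLocalJ n R f x := fun x =>
    h.isLocalJ x (ne_zero_of_mem_Icc x) x.2.2
  have hirr' : ∀ k x, ¬ RStar n R k x x := fun k x ⟨i, _, h2, h3⟩ => hirr i h2 x h3
  have hev : ∀ k (x : Set.Icc 1 lam) (p : Ordinal.{v} → Prop), (∀ᶠ z in nb k x, p z) →
      ∀ᶠ z : Set.Icc 1 lam in @nhds _ (icardIcc lam k) x, p z := fun k x p hp => by
    rw [← map_nhds_icardIcc] at hp
    exact hp
  have hself : ∀ k ≤ n, ∀ x : Set.Icc 1 lam, IsHereditaryRoot n R (k + 1) (f x) →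
      ∀ᶠ z : Set.Icc 1 lam in @nhds _ (icardIcc lam k) x, z ≠ x → RStar n R k (f x) (f z) :=
    fun k hk x hx => (hev k x _ ((hJ x).self k hk hx)).mono fun z hz hzx =>
      hz fun h => hzx (Subtype.ext h)
  have hdisc : ∀ k ≤ n, ∀ w, IsHereditaryRoot n R (k + 1) w →
      @IsDiscrete _ (icardIcc lam k) ((fun x : Set.Icc 1 lam => f x) ⁻¹' {w}) := by
    intro k hk w hw
    refine isDiscrete_icardIcc fun x hx => ?_
    obtain rfl : f x = w := hx
    refine (hself k hk x hw).mono fun z hz hzx (hzw : f z = f x) => ?_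
    exact hirr' k (f x) (by simpa only [hzw] using hz hzx)
  have hopen : ∀ k ≤ n, @IsOpenMap _ T (icardIcc lam k) (upsetTop (R k))
      (fun x : Set.Icc 1 lam => f x) := by
    rintro k hk O hO _ ⟨x, hx, rfl⟩ y hy
    have hfr := (hJ x).freq k hk y hy
    rw [← map_nhds_icardIcc] at hfr
    obtain ⟨z, hz1, hz2⟩ := (Frequently.and_eventually (frequently_map.1 hfr)
      (isOpen_icardIcc_iff.1 hO x hx)).exists
    exact ⟨z, hz2, hz1⟩
  have htop : ∀ w, IsHereditaryRoot n R (n + 1) w := fun w y ⟨i, h1, h2, _⟩ => by omega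
  refine ⟨⟨?_, ?_, fun w => hdisc n le_rfl w (htop w)⟩, ?_, ?_, ?_⟩
  · rw [continuous_def]
    intro U hU
    rw [isOpen_icardIcc_iff]
    intro x hx
    filter_upwards [hself n le_rfl x (htop _)] with z hz
    by_cases hzx : z = x
    · rwa [hzx]
    · obtain ⟨i, h1, h2, h3⟩ := hz hzx
      obtain rfl : i = n := le_antisymm h2 h1
      exact hU _ hx _ h3
  · exact hopen n le_rfl
  · exact hopen
  · intro k hk w hw
    have habove : ∀ x : Set.Icc 1 lam, RStar n R k w (f x) →
        ∀ᶠ z : Set.Icc 1 lam in @nhds _ (icardIcc lam k) x, RStar n R k w (f z) :=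
      fun x hx => hev k x _ ((hJ x).above k hk.le w hw hx)
    refine ⟨isOpen_icardIcc_iff.2 habove, isOpen_icardIcc_iff.2 ?_⟩
    rintro x (hx | hx)
    · exact (habove x hx).mono fun z hz => Or.inl hz
    · obtain rfl : f x = w := hx
      filter_upwards [hself k hk.le x hw] with z hz
      by_cases hzx : z = x
      · exact Or.inr (by rw [hzx]; rfl)
      · exact Or.inl (hz hzx)
  · exact fun k hk => hdisc k hk.le

theorem IsCover.isAlgebraPreserving {S : Set T} {f : Ordinal.{v} → T} (h : IsCover n R S lam f) :
    IsAlgebraPreserving (nPeriodicIcc n lam) (fun x : Set.Icc 1 lam => f x) := by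
  intro A
  obtain ⟨_, ⟨F, hF, hF', rfl⟩, hX⟩ := h.algebra A
  refine ⟨_, ⟨(· ∩ Set.Iio (lam + 1)) '' F, hF.image _, ?_, rfl⟩, ?_⟩
  · rintro _ ⟨X, hX, rfl⟩
    exact mem_periodicGen (hF' hX)
  · ext x
    have hx : (x : Ordinal.{v}) < lam + 1 := by
      rw [← succ_eq_add_one, lt_succ_iff]; exact x.2.2
    have := hX x (ne_zero_of_mem_Icc x) x.2.2
    simp only [Set.mem_preimage, ← this, Set.mem_sUnion, Set.exists_mem_image, Set.mem_inter_iff,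
      Set.mem_Iio, hx, and_true]

end Global

end OrdGLP

theorem lemma5p1 (n : ℕ) (T : Type u) (R : ℕ → T → T → Prop) (hT : OrdGLP.IsJTree n T R) :
    ∃ lam : Ordinal.{v}, lam < OrdGLP.tower (n + 2) ∧
      ∃ f : Set.Icc 1 lam → T, Function.Surjective f ∧
        OrdGLP.IsJMorphism n (OrdGLP.icardIcc lam) R f ∧
        OrdGLP.IsAlgebraPreserving (OrdGLP.nPeriodicIcc n lam) f := by
  obtain ⟨_, _, hirr, lam, f, hf⟩ := hT.isCoverable
  refine ⟨lam, hf.lt_tower, fun x => f x, fun u => ?_, hf.isJMorphism hirr,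
    hf.isAlgebraPreserving⟩
  obtain ⟨x, h0, hx, rfl⟩ := hf.surj u (Set.mem_univ u)
  exact ⟨⟨x, Order.one_le_iff_ne_zero.2 h0, hx⟩, rfl⟩
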